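/- Let $T$ be the rooted ternary tree, whose vertices are the finite words over $\{0,1,2\}$ (letters added modulo $3$), and let $\Gamma\le\mathrm{Aut}(T)$ be the Fabrykowski--Gupta group, generated by the automorphisms $a$ and $s$ given by $a(x\sigma)=(x+1)\sigma$, and recursively $s(0\sigma)=0\,a(\sigma)$, $s(1\sigma)=1\sigma$, $s(2\sigma)=2\,s(\sigma)$. Let $\nu$ be the uniform Bernoulli measure on the boundary $\partial T=\{0,1,2\}^{\mathbb N}$, and let $\pi$ be the unitary representation of $\Gamma$ in $L^2(\partial T,\nu)$, $(\pi(g)f)(\xi)=f(g^{-1}\xi)$. The spectrum of $\pi$ is by definition the spectrum of the bounded operator $\Delta=\pi(a)+\pi(a^{-1})+\pi(s)+\pi(s^{-1})$. Let $\Delta_n=a_n+a_n^{-1}+s_n+s_n^{-1}$, where $a_n,s_n$ are the $3^n\times 3^n$ permutation matrices of $a,s$ acting on words of length $n$, and let $\tau_n$ be the normalized counting measure of the eigenvalues of $\Delta_n$ with multiplicity. The empiric spectral measure is the weak limit of $\tau_n$ as $n\to\infty$. Put $N_0=\{0\}$ and $N_{k+1}=\{\pm\sqrt{6+z}: z\in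 N_k\}$ for $k\ge 0$, and let $$P=\bigcup_{k\ge0}(1+N_k)=\{1,\ 1\pm\sqrt6,\ 1\pm\sqrt{6\pm\sqrt6},\ 1\pm\sqrt{6\pm\sqrt{6\pm\sqrt6}},\ \dots\}.$$ Then: 1. The spectrum of $\pi$ is the closure of $\{4\}\cup P$. 2. This closure is the disjoint union of $P$ and a Cantor set $K\subset\mathbb R$ which has Lebesgue measure zero and is symmetric about $1$. The set $P$ is countable, each of its points is isolated in the spectrum, and the set of accumulation points of $P$ is exactly $K$. 3. The empiric spectral measure $\tau$ exists and is a probability measure, it is supported on $P$ in the sense that $\tau(\mathbb R\setminus P)=0$, and its values are $\tau(\{4\})=0$ and $\tau(\{x\})=3^{-(k+1)}$ for every $k\ge0$ and every $x\in 1+N_k$ (that is, $\tfrac13$ at $1$, $\tfrac19$ at $1\pm\sqrt6$, $\tfrac1{27}$ at $1\pm\sqrt{6\pm\sqrt6}$, and so on). -/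

import Mathlib

open MeasureTheory Topology Filter Set

/-! ### The rooted ternary tree and its automorphisms -/

namespace TernaryTree

/-- Vertices of the rooted ternary tree: finite sequences over `{0, 1, 2}`; the root is `[]`. -/
abbrev Vertex : Type := List (Fin 3)

/-- `w` is a child of `v`: it is obtained from `v` by adjoining one letter on the right. -/
def IsChild (v w : Vertex) : Prop := ∃ x : Fin 3, w = v ++ [x]

/-- The group of automorphisms of the rooted tree: the bijections of the vertex set that preserve
the parent-child relation. -/
def Aut : Subgroup (Equiv.Perm Vertex) where
  carrier := {g | ∀ v w, IsChild v w ↔ IsChild (g v) (g w)}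
  one_mem' := fun _ _ => Iff.rfl
  mul_mem' := fun {g h} hg hh v w => (hh v w).trans (hg (h v) (h w))
  inv_mem' := fun {g} hg v w => by
    have := hg (g⁻¹ v) (g⁻¹ w)
    simpa using this.symm

theorem Aut.map_nil (g : Aut) : g.1 [] = [] := by
  rcases List.eq_nil_or_concat (g.1 []) with h | ⟨u, x, h⟩
  · exact h
  · exfalso
    have h1 : IsChild (g.1 (g.1.symm u)) (g.1 []) := ⟨x, by simpa using h⟩
    obtain ⟨y, hy⟩ := (g.2 _ _).2 h1
    simp at hy

theorem Aut.map_concat (g : Aut) (v : Vertex) (x : Fin 3) : ∃ y, g.1 (v ++ [x]) = g.1 v ++ [y] :=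
  (g.2 v (v ++ [x])).1 ⟨x, rfl⟩

theorem Aut.length_map (g : Aut) (v : Vertex) : (g.1 v).length = v.length := by
  induction v using List.reverseRecOn with
  | nil => simp [Aut.map_nil g]
  | append_singleton v x ih =>
    obtain ⟨y, hy⟩ := Aut.map_concat g v x
    simp [hy, ih]

/-! ### The boundary of the tree, its uniform measure, and the action on it -/

/-- The boundary of the tree: infinite sequences over `{0, 1, 2}`. -/
abbrev Boundary : Type := ℕ → Fin 3

/-- The length-`n` prefix of a boundary point. -/
def pref (ξ : Boundary) (n : ℕ) : Vertex := List.ofFn fun i : Fin n => ξ i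

theorem length_pref (ξ : Boundary) (n : ℕ) : (pref ξ n).length = n := by simp [pref]

theorem pref_succ (ξ : Boundary) (n : ℕ) : pref ξ (n + 1) = pref ξ n ++ [ξ n] := by
  unfold pref
  rw [List.ofFn_succ_last]
  rfl

theorem pref_eq_iff {ξ η : Boundary} {n : ℕ} : pref ξ n = pref η n ↔ ∀ i < n, ξ i = η i := by
  unfold pref
  rw [List.ofFn_inj, funext_iff]
  exact ⟨fun h i hi => h ⟨i, hi⟩, fun h i => h i i.2⟩

/-- The action of a tree automorphism on the boundary: the `n`-th letter of `g ξ` is the last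
letter of the image under `g` of the prefix of `ξ` of length `n + 1`. -/
def act (g : Aut) (ξ : Boundary) : Boundary := fun n => (g.1 (pref ξ (n + 1))).getLastD 0

theorem pref_act (g : Aut) (ξ : Boundary) (n : ℕ) : pref (act g ξ) n = g.1 (pref ξ n) := by
  induction n with
  | zero => simp [pref, Aut.map_nil g]
  | succ n ih =>
    obtain ⟨y, hy⟩ := Aut.map_concat g (pref ξ n) (ξ n)
    rw [pref_succ, ih, pref_succ, hy, act, pref_succ, hy]
    simp

theorem eq_of_pref {ξ η : Boundary} (h : ∀ n, pref ξ n = pref η n) : ξ = η :=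
  funext fun n => pref_eq_iff.1 (h (n + 1)) n (Nat.lt_succ_self n)

theorem act_one (ξ : Boundary) : act 1 ξ = ξ :=
  eq_of_pref fun n => by rw [pref_act]; rfl

theorem act_mul (g h : Aut) (ξ : Boundary) : act (g * h) ξ = act g (act h ξ) :=
  eq_of_pref fun n => by rw [pref_act, pref_act, pref_act]; rfl

/-- The uniform Bernoulli measure on the boundary. -/
noncomputable def bernoulli : Measure Boundary :=
  Measure.infinitePi fun _ : ℕ => (PMF.uniformOfFintype (Fin 3)).toMeasure

instance : IsProbabilityMeasure bernoulli := by unfold bernoulli; infer_instance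

theorem measurable_act (g : Aut) : Measurable (act g) := by
  refine measurable_pi_lambda _ fun n => ?_
  have h : (fun ξ : Boundary => act g ξ n) =
      (fun u : Fin (n + 1) → Fin 3 => (g.1 (List.ofFn u)).getLastD 0) ∘
        (fun ξ : Boundary => fun i : Fin (n + 1) => ξ i) := rfl
  rw [h]
  exact (measurable_of_countable _).comp (by fun_prop)

theorem measurableSet_cylinder (w : Vertex) (n : ℕ) : MeasurableSet {ξ | pref ξ n = w} := by
  have h : {ξ | pref ξ n = w} = (fun ξ : Boundary => fun i : Fin n => ξ i) ⁻¹'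
      {u : Fin n → Fin 3 | List.ofFn u = w} := rfl
  rw [h]
  exact (show Measurable (fun ξ : Boundary => fun i : Fin n => ξ i) by fun_prop)
    (Set.toFinite _).measurableSet

theorem bernoulli_cylinder (w : Vertex) :
    bernoulli {ξ | pref ξ w.length = w} = (3 : ENNReal)⁻¹ ^ w.length := by
  have h : {ξ : Boundary | pref ξ w.length = w} =
      Set.pi (Finset.range w.length : Finset ℕ) fun i => {w.getD i 0} := by
    ext ξ
    simp only [Set.mem_ofPred_eq, Set.mem_pi, Finset.coe_range, Set.mem_Iio, Set.mem_singleton_iff]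
    constructor
    · intro h i hi
      have h2 : (pref ξ w.length)[i]? = w[i]? := by rw [h]
      simp [pref, hi] at h2
      simp [hi, h2]
    · intro h
      refine List.ext_getElem (by simp [pref]) fun i h1 h2 => ?_
      have := h i h2
      simp [pref, this, h2]
  rw [h, bernoulli, Measure.infinitePi_pi _ (fun _ _ => MeasurableSet.singleton _)]
  simp

theorem measurePreserving_act (g : Aut) : MeasurePreserving (act g) bernoulli bernoulli := by
  refine ⟨measurable_act g, ?_⟩
  conv_rhs => rw [bernoulli]
  refine Measure.eq_infinitePi _ fun s t ht => ?_
  rw [← Measure.infinitePi_pi _ (fun i _ => ht i)]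
  change _ = bernoulli _
  set B : Set Boundary := Set.pi s t with hB
  obtain ⟨n, hn⟩ : ∃ n, ∀ i ∈ s, i < n :=
    ⟨s.sup id + 1, fun i hi => Nat.lt_succ_of_le (Finset.le_sup (f := id) hi)⟩
  have hfin : ((fun ξ => pref ξ n) '' B).Finite := by
    refine (List.finite_length_eq (Fin 3) n).subset ?_
    rintro _ ⟨ξ, -, rfl⟩
    exact length_pref ξ n
  have hBm : MeasurableSet B := MeasurableSet.pi s.countable_toSet fun i _ => ht i
  have hBU : B = ⋃ w ∈ hfin.toFinset, {ξ | pref ξ n = w} := by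
    ext ξ
    simp only [Set.mem_iUnion, Set.Finite.mem_toFinset, Set.mem_image, Set.mem_ofPred_eq,
      exists_prop, exists_eq_right']
    constructor
    · exact fun h => ⟨ξ, h, rfl⟩
    · rintro ⟨η, hη, h⟩ i hi
      rw [← pref_eq_iff.1 h i (hn i hi)]
      exact hη i hi
  have hlen : ∀ w ∈ hfin.toFinset, w.length = n := by
    intro w hw
    obtain ⟨ξ, -, rfl⟩ := hfin.mem_toFinset.1 hw
    exact length_pref ξ n
  rw [Measure.map_apply (measurable_act g) hBm, hBU, Set.preimage_iUnion₂,
    measure_biUnion_finset, measure_biUnion_finset]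
  · refine Finset.sum_congr rfl fun w hw => ?_
    have h1 : act g ⁻¹' {ξ | pref ξ n = w} =
        {ξ | pref ξ (g⁻¹.1 w).length = g⁻¹.1 w} := by
      ext ξ
      rw [Set.mem_preimage, Set.mem_ofPred_eq, Set.mem_ofPred_eq, pref_act, Aut.length_map,
        hlen w hw]
      exact (Equiv.eq_symm_apply g.1).symm
    have h2 := bernoulli_cylinder w
    rw [hlen w hw] at h2
    rw [h1, bernoulli_cylinder, Aut.length_map, hlen w hw, h2]
  · intro v _ w _ hvw
    exact Set.disjoint_left.2 fun ξ h1 h2 => hvw (h1.symm.trans h2)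
  · exact fun w _ => measurableSet_cylinder w n
  · intro v _ w _ hvw
    exact Set.disjoint_left.2 fun ξ h1 h2 => hvw (h1.symm.trans h2)
  · exact fun w _ => measurable_act g (measurableSet_cylinder w n)

/-! ### The unitary representation in `L²` of the boundary -/

/-- The Hilbert space of complex square-integrable functions on the boundary. -/
noncomputable abbrev L2Boundary : Type := Lp ℂ 2 bernoulli

/-- The isometry `f ↦ f ∘ g⁻¹` of `L²` of the boundary. -/
noncomputable def translate (g : Aut) : L2Boundary →ₗᵢ[ℂ] L2Boundary :=
  Lp.compMeasurePreservingₗᵢ ℂ (act g⁻¹) (measurePreserving_act g⁻¹)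

theorem translate_coeFn (g : Aut) (f : L2Boundary) :
    translate g f =ᵐ[bernoulli] fun ξ => f (act g⁻¹ ξ) :=
  Lp.coeFn_compMeasurePreserving f (measurePreserving_act g⁻¹)

theorem translate_one (f : L2Boundary) : translate 1 f = f := by
  refine Lp.ext ((translate_coeFn 1 f).trans (Eventually.of_forall fun ξ => ?_))
  simp [act_one]

theorem translate_mul (g h : Aut) (f : L2Boundary) :
    translate (g * h) f = translate g (translate h f) := by
  refine Lp.ext ((translate_coeFn (g * h) f).trans ?_)
  refine EventuallyEq.trans ?_ (translate_coeFn g (translate h f)).symm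
  have := (measurePreserving_act g⁻¹).quasiMeasurePreserving.ae (translate_coeFn h f)
  filter_upwards [this] with ξ hξ
  rw [hξ, mul_inv_rev, act_mul]

/-- The unitary representation of the automorphism group of the tree in `L²` of the boundary,
`(g f)(ξ) = f (g⁻¹ ξ)`. -/
noncomputable def boundaryRep : Aut →* (L2Boundary ≃ₗᵢ[ℂ] L2Boundary) where
  toFun g :=
    { toLinearEquiv := LinearEquiv.ofLinearMap (translate g).toLinearMap (translate g⁻¹).toLinearMap
        (LinearMap.ext fun f => by
          change translate g (translate g⁻¹ f) = f
          rw [← translate_mul, mul_inv_cancel, translate_one])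
        (LinearMap.ext fun f => by
          change translate g⁻¹ (translate g f) = f
          rw [← translate_mul, inv_mul_cancel, translate_one])
      norm_map' := (translate g).norm_map }
  map_one' := LinearIsometryEquiv.ext translate_one
  map_mul' := fun g h => LinearIsometryEquiv.ext (translate_mul g h)

end TernaryTree

/-! ### Hecke type operators and spectra of representations -/

/-- The Hecke type operator `∑ s ∈ S, τ s` of a unitary representation `τ`. -/
noncomputable def heckeOperator {G H : Type*} [Group G] [NormedAddCommGroup H]
    [InnerProductSpace ℂ H] (τ : G →* (H ≃ₗᵢ[ℂ] H)) (S : Finset G) : H →L[ℂ] H :=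
  ∑ s ∈ S, ((τ s).toContinuousLinearEquiv : H →L[ℂ] H)

/-- The spectrum of a unitary representation with respect to a finite symmetric set of
generators. -/
def repSpectrum {G H : Type*} [Group G] [NormedAddCommGroup H]
    [InnerProductSpace ℂ H] (τ : G →* (H ≃ₗᵢ[ℂ] H)) (S : Finset G) : Set ℂ :=
  spectrum ℂ (heckeOperator τ S)

/-- The spectral measure of a finite symmetric matrix: the normalized counting measure of its
eigenvalues, taken with multiplicity. -/
noncomputable def eigenvalueDistribution {ι : Type*} [Fintype ι] [DecidableEq ι] [Nonempty ι]
    {M : Matrix ι ι ℝ} (hM : M.IsHermitian) : ProbabilityMeasure ℝ :=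
  ⟨(Fintype.card ι : ENNReal)⁻¹ • ∑ i, Measure.dirac (hM.eigenvalues i), ⟨by
    simp [ENNReal.inv_mul_cancel]⟩⟩

/-! ### The Fabrykowski–Gupta group -/

namespace FabrykowskiGupta

open TernaryTree

/-- The action of the rooted automorphism `a` (for `c = 1`) and of its inverse (for `c = -1`):
`x σ ↦ (x + c) σ`, with addition modulo `3`. -/
def rotFun (c : Fin 3) : Vertex → Vertex
  | [] => []
  | x :: σ => (x + c) :: σ

/-- The recursion `0 σ ↦ 0 (a^c σ)`, `1 σ ↦ 1 σ`, `2 σ ↦ 2 (s^c σ)`, describing the action of `s`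
(for `c = 1`) and of its inverse (for `c = -1`). -/
def dirFun (c : Fin 3) : Vertex → Vertex
  | [] => []
  | 0 :: σ => 0 :: rotFun c σ
  | 1 :: σ => 1 :: σ
  | 2 :: σ => 2 :: dirFun c σ

theorem rotFun_neg {c d : Fin 3} (h : c + d = 0) (v : Vertex) : rotFun d (rotFun c v) = v := by
  cases v with
  | nil => rfl
  | cons x σ => simp [rotFun, add_assoc, h]

theorem dirFun_neg {c d : Fin 3} (h : c + d = 0) (v : Vertex) : dirFun d (dirFun c v) = v := by
  induction v with
  | nil => rfl
  | cons x σ ih =>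
    fin_cases x
    · exact congrArg (List.cons 0) (rotFun_neg h σ)
    · rfl
    · exact congrArg (List.cons 2) ih

theorem rotFun_child (c : Fin 3) {v w : Vertex} (h : IsChild v w) :
    IsChild (rotFun c v) (rotFun c w) := by
  obtain ⟨x, rfl⟩ := h
  cases v with
  | nil => exact ⟨x + c, rfl⟩
  | cons y σ => exact ⟨x, rfl⟩

theorem IsChild.cons {v w : Vertex} (x : Fin 3) (h : IsChild v w) :
    IsChild (x :: v) (x :: w) := by
  obtain ⟨y, rfl⟩ := h
  exact ⟨y, rfl⟩

theorem dirFun_child (c : Fin 3) {v w : Vertex} (h : IsChild v w) :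
    IsChild (dirFun c v) (dirFun c w) := by
  obtain ⟨x, rfl⟩ := h
  induction v with
  | nil => fin_cases x <;> exact ⟨_, rfl⟩
  | cons y σ ih =>
    fin_cases y
    · exact IsChild.cons 0 (rotFun_child c ⟨x, rfl⟩)
    · exact IsChild.cons 1 ⟨x, rfl⟩
    · exact IsChild.cons 2 ih

/-- The rooted automorphism `a`, with `a (x σ) = (x + 1) σ`. -/
def a : Aut :=
  ⟨⟨rotFun 1, rotFun (-1), rotFun_neg rfl, rotFun_neg rfl⟩, fun v w =>
    ⟨rotFun_child 1, fun h => by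
      have := rotFun_child (-1) h
      simpa [rotFun_neg (show (1 : Fin 3) + -1 = 0 from rfl)] using this⟩⟩

/-- The automorphism `s`, with `s (0 σ) = 0 a(σ)`, `s (1 σ) = 1 σ`, `s (2 σ) = 2 s(σ)`. -/
def s : Aut :=
  ⟨⟨dirFun 1, dirFun (-1), dirFun_neg rfl, dirFun_neg rfl⟩, fun v w =>
    ⟨dirFun_child 1, fun h => by
      have := dirFun_child (-1) h
      simpa [dirFun_neg (show (1 : Fin 3) + -1 = 0 from rfl)] using this⟩⟩

/-- The Fabrykowski–Gupta group, generated by `a` and `s`. -/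
def Gam : Subgroup Aut := Subgroup.closure {a, s}

/-- `a` as an element of the group. -/
def aG : Gam := ⟨a, Subgroup.subset_closure (by simp)⟩

/-- `s` as an element of the group. -/
def sG : Gam := ⟨s, Subgroup.subset_closure (by simp)⟩

open Classical in
/-- The symmetric generating set `{a, a⁻¹, s, s⁻¹}`. -/
noncomputable def gens : Finset Gam := {aG, aG⁻¹, sG, sG⁻¹}

theorem inv_mem_gens {g : Gam} (h : g ∈ gens) : g⁻¹ ∈ gens := by
  simp only [gens, Finset.mem_insert, Finset.mem_singleton] at h ⊢
  rcases h with rfl | rfl | rfl | rfl <;> simp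

/-- The unitary representation `π` of the group in `L²` of the boundary of the tree. -/
noncomputable def rep : Gam →* (L2Boundary ≃ₗᵢ[ℂ] L2Boundary) := boundaryRep.comp Gam.subtype

/-- The permutation matrix of `g` acting on the words of length `n`. -/
def levelMatrix (n : ℕ) (g : Gam) : Matrix (List.Vector (Fin 3) n) (List.Vector (Fin 3) n) ℝ :=
  Matrix.of fun u v => if g.1.1 v.1 = u.1 then 1 else 0

/-- The operator `Δ_n = a_n + a_n⁻¹ + s_n + s_n⁻¹` of the permutation representation on the words
of length `n`, i.e. the adjacency matrix of the `n`-th finite Schreier graph. -/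
noncomputable def levelLaplacian (n : ℕ) :
    Matrix (List.Vector (Fin 3) n) (List.Vector (Fin 3) n) ℝ :=
  ∑ g ∈ gens, levelMatrix n g

theorem levelMatrix_conjTranspose (n : ℕ) (g : Gam) :
    (levelMatrix n g).conjTranspose = levelMatrix n g⁻¹ := by
  ext u v
  have h : (g.1.1 u.1 = v.1) ↔ (g⁻¹.1.1 v.1 = u.1) := by
    constructor
    · intro h
      rw [← h]
      exact g.1.1.symm_apply_apply u.1
    · intro h
      rw [← h]
      exact g.1.1.apply_symm_apply v.1
  simp [levelMatrix, Matrix.conjTranspose_apply, h]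

theorem levelLaplacian_isHermitian (n : ℕ) : (levelLaplacian n).IsHermitian := by
  unfold Matrix.IsHermitian levelLaplacian
  rw [Matrix.conjTranspose_sum]
  refine Finset.sum_nbij' (fun g => g⁻¹) (fun g => g⁻¹) (fun g hg => inv_mem_gens hg)
    (fun g hg => inv_mem_gens hg) (fun g _ => inv_inv g) (fun g _ => inv_inv g)
    (fun g _ => levelMatrix_conjTranspose n g)

/-- The spectral measure of `Δ_n`. -/
noncomputable def levelSpectralMeasure (n : ℕ) : ProbabilityMeasure ℝ :=
  eigenvalueDistribution (levelLaplacian_isHermitian n)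

/-- The empiric spectral measure is the weak limit of the spectral measures of the `Δ_n`. -/
def IsEmpiricSpectralMeasure (τ : ProbabilityMeasure ℝ) : Prop :=
  Tendsto levelSpectralMeasure atTop (𝓝 τ)

/-! ### The explicit sets -/

/-- The nested radicals of depth `k`: `{0}`, `{±√6}`, `{±√(6 ± √6)}`, … -/
def nestedRadicals : ℕ → Set ℝ
  | 0 => {0}
  | k + 1 => {y | ∃ z ∈ nestedRadicals k, y = √(6 + z) ∨ y = -√(6 + z)}

/-- `{1}`, `{1 ± √6}`, `{1 ± √(6 ± √6)}`, … -/
def eigenvalueLevel (k : ℕ) : Set ℝ := {x | ∃ y ∈ nestedRadicals k, x = 1 + y}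

/-- `{1, 1 ± √6, 1 ± √(6 ± √6), …}` -/
def nestedEigenvalues : Set ℝ := ⋃ k, eigenvalueLevel k

/-- `{4, 1, 1 ± √6, 1 ± √(6 ± √6), …}` -/
def eigenvalueSet : Set ℝ := {4} ∪ nestedEigenvalues

end FabrykowskiGupta

/-- A subset of the line is a Cantor set if it is homeomorphic to the Cantor space. -/
def IsCantorSet (K : Set ℝ) : Prop := Nonempty (K ≃ₜ (ℕ → Bool))

namespace FabrykowskiGupta

/-! ### Dynamics of `y ↦ y² - 6` -/

/-! Put `A = 1 + a + a⁻¹`, `S = 1 + s + s⁻¹` and `N = Δ - 1 = A + S - 3`. Since `a` and `s` have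
order three, `A² = 3A` and `S² = 3S`. Let `ι` be inflation, that is, composition with deletion of
the first letter. Then `Aι = 3ι`, the range of `A` lies in that of `ι`, and self-similarity gives
`ASι = ι(N + 6)`, where the `N` on the right acts one level down. If `Nv = zv`, then `ASAv = z²Av`,
so writing `Av = ιg` yields `Ng = (z² - 6)g`; conversely `Nf = (z² - 6)f` makes `Sιf + zιf` an
eigenvector for `z`, nonzero unless `z = 0` or `z = -3`. The spectrum is thus governed by the
dynamics of `q(y) = y² - 6`.

In `L²` this is upgraded from eigenvectors to invertibility (`renormalization_bijective`). A real
spectral point of `N` therefore either reaches `0` under `q` or has an orbit that stays in the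
bounded spectrum, which puts it in the Julia set `J` of `q`. Conversely, `0` is an eigenvalue and
all its iterated preimages, the nested radicals, are lifted from it; they accumulate exactly on `J`.
The inverse branches of `q` contract by `1/3` near `J`: two such branches give Lebesgue measure
zero, and since `0 ∉ J` the signs along an orbit code `J` by binary sequences.

For the measure, lower bounds on multiplicities suffice. On level `n` the kernel of `N` has
dimension at least `3 ^ (n - 1)` for `n ≥ 1`, and lifting gives every radical of depth `k < n`
multiplicity at least `3 ^ (n - k - 1)`. The resulting atoms `3⁻⁽ᵏ⁺¹⁾`, with `2 ^ k` of them at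
depth `k`, already have total mass `1`, so the portmanteau theorem identifies the limit. -/

/-- The quadratic map whose backward orbit of `0` consists of the nested radicals. -/
def quadMap (y : ℝ) : ℝ := y ^ 2 - 6

/-- The points whose forward orbit under `quadMap` stays in `[-3, 3]`. -/
def juliaSet : Set ℝ := {y | ∀ n, quadMap^[n] y ∈ Icc (-3 : ℝ) 3}

/-- The two inverse branches of `quadMap`. -/
noncomputable def branch (b : Bool) (z : ℝ) : ℝ := if b then √(6 + z) else -√(6 + z)

theorem quadMap_branch (b : Bool) {z : ℝ} (hz : -6 ≤ z) : quadMap (branch b z) = z := by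
  have h := Real.sq_sqrt (show 0 ≤ 6 + z by linarith)
  cases b <;> simp [branch, quadMap, h]

theorem branch_quadMap (y : ℝ) : branch (decide (0 < y)) (quadMap y) = y := by
  have h : √(6 + quadMap y) = |y| := by
    rw [quadMap, add_sub_cancel, Real.sqrt_sq_eq_abs]
  by_cases hy : 0 < y
  · simp [branch, hy, h, abs_of_pos hy]
  · simp [branch, hy, h, abs_of_nonpos (not_lt.1 hy)]

theorem quadMap_eq_iff {y z : ℝ} (hz : -6 ≤ z) : quadMap y = z ↔ ∃ b, y = branch b z := by
  constructor
  · rintro rfl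
    exact ⟨_, (branch_quadMap y).symm⟩
  · rintro ⟨b, rfl⟩
    exact quadMap_branch b hz

theorem abs_branch (b : Bool) (z : ℝ) : |branch b z| = √(6 + z) := by
  cases b <;> simp [branch, abs_of_nonneg, Real.sqrt_nonneg]

theorem branch_pos_iff (b : Bool) {z : ℝ} (hz : -6 < z) : 0 < branch b z ↔ b = true := by
  have := Real.sqrt_pos.2 (show 0 < 6 + z by linarith)
  cases b
  · simp [branch]
  · simpa [branch] using this

/-- Only an upper bound on `z` is needed, because `√` of a negative number is `0`. -/
theorem branch_mem_Icc (b : Bool) {z : ℝ} (hz : z ≤ 3) : branch b z ∈ Icc (-3 : ℝ) 3 := by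
  rw [mem_Icc, ← abs_le, abs_branch, Real.sqrt_le_left (by norm_num)]
  linarith

/-- On `[-3, ∞)` each root is at least `√3 ≥ 3/2`, so the two roots sum to at least `3`, and the
difference of their squares is `z - w`. That the factor is below `1/2` is what later makes
`juliaSet` null. -/
theorem abs_branch_sub_branch_le (b : Bool) {z w : ℝ} (hz : -3 ≤ z) (hw : -3 ≤ w) :
    |branch b z - branch b w| ≤ 1 / 3 * |z - w| := by
  have h1 : |branch b z - branch b w| = |√(6 + z) - √(6 + w)| := by
    cases b
    · simp only [branch, Bool.false_eq_true, if_false]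
      rw [← abs_neg]
      ring_nf
    · simp [branch]
  have hz' : 3 / 2 ≤ √(6 + z) := Real.le_sqrt_of_sq_le (by linarith)
  have hw' : 3 / 2 ≤ √(6 + w) := Real.le_sqrt_of_sq_le (by linarith)
  have h2 : |z - w| = |√(6 + z) - √(6 + w)| * (√(6 + z) + √(6 + w)) := by
    rw [← abs_of_nonneg (show 0 ≤ √(6 + z) + √(6 + w) by linarith), ← abs_mul]
    congr 1
    have e1 := Real.sq_sqrt (show 0 ≤ 6 + z by linarith)
    have e2 := Real.sq_sqrt (show 0 ≤ 6 + w by linarith)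
    linear_combination e2 - e1
  rw [h1, h2]
  nlinarith [abs_nonneg (√(6 + z) - √(6 + w))]

theorem continuous_quadMap : Continuous quadMap := by
  unfold quadMap
  fun_prop

/-! ### Nested radicals -/

theorem mem_Ioo_of_mem_nestedRadicals {k : ℕ} {z : ℝ} (hz : z ∈ nestedRadicals k) :
    z ∈ Ioo (-3 : ℝ) 3 := by
  induction k generalizing z with
  | zero =>
    rw [nestedRadicals, mem_singleton_iff] at hz
    norm_num [hz]
  | succ k ih =>
    obtain ⟨w, hw, hz⟩ := hz
    have := ih hw
    rw [mem_Ioo, ← abs_lt]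
    have h : |z| = √(6 + w) := by
      rcases hz with rfl | rfl <;> simp [abs_of_nonneg, Real.sqrt_nonneg]
    rw [h, Real.sqrt_lt' (by norm_num)]
    linarith [this.2]

theorem mem_nestedRadicals_succ {k : ℕ} {y : ℝ} :
    y ∈ nestedRadicals (k + 1) ↔ quadMap y ∈ nestedRadicals k := by
  constructor
  · rintro ⟨z, hz, h⟩
    have : quadMap y = z := (quadMap_eq_iff (by linarith [(mem_Ioo_of_mem_nestedRadicals hz).1])).2
      (h.elim (fun h => ⟨true, by simpa [branch] using h⟩)
        fun h => ⟨false, by simpa [branch] using h⟩)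
    rwa [this]
  · intro h
    refine ⟨_, h, ?_⟩
    have := branch_quadMap y
    by_cases hy : 0 < y
    · left
      simpa [branch, hy] using this.symm
    · right
      simpa [branch, hy] using this.symm

theorem mem_nestedRadicals_iff {k : ℕ} {y : ℝ} : y ∈ nestedRadicals k ↔ quadMap^[k] y = 0 := by
  induction k generalizing y with
  | zero => rfl
  | succ k ih => rw [mem_nestedRadicals_succ, ih, Function.iterate_succ_apply]

/-- The critical value `-6` of `quadMap` lies outside `(-3, 3)`. Hence the critical point `0` is not
its own iterated preimage, and different depths are disjoint. -/
theorem zero_notMem_nestedRadicals_succ (k : ℕ) : (0 : ℝ) ∉ nestedRadicals (k + 1) := by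
  rw [mem_nestedRadicals_succ]
  intro h
  have := (mem_Ioo_of_mem_nestedRadicals h).1
  norm_num [quadMap] at this

theorem nestedRadicals_disjoint {j k : ℕ} {y : ℝ} (hj : y ∈ nestedRadicals j)
    (hk : y ∈ nestedRadicals k) : j = k := by
  induction j generalizing k y with
  | zero =>
    rw [nestedRadicals, mem_singleton_iff] at hj
    subst hj
    cases k with
    | zero => rfl
    | succ k => exact absurd hk (zero_notMem_nestedRadicals_succ k)
  | succ j ih =>
    cases k with
    | zero =>
      rw [nestedRadicals, mem_singleton_iff] at hk
      subst hk
      exact absurd hj (zero_notMem_nestedRadicals_succ j)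
    | succ k => rw [ih (mem_nestedRadicals_succ.1 hj) (mem_nestedRadicals_succ.1 hk)]

theorem branch_injOn (b : Bool) : InjOn (branch b) (Ici (-6)) := fun z hz w hw h => by
  rw [← quadMap_branch b hz, h, quadMap_branch b hw]

/-- The nested radicals of depth `k`, as a finite set. -/
noncomputable def radicalFinset : ℕ → Finset ℝ
  | 0 => {0}
  | k + 1 => (radicalFinset k).image (branch true) ∪ (radicalFinset k).image (branch false)

theorem coe_radicalFinset (k : ℕ) : (radicalFinset k : Set ℝ) = nestedRadicals k := by
  induction k with
  | zero => simp [radicalFinset, nestedRadicals]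
  | succ k ih =>
    ext y
    simp only [radicalFinset, Finset.coe_union, Finset.coe_image, ih, nestedRadicals, branch,
      mem_union, mem_image, mem_ofPred_eq, if_true, Bool.false_eq_true, if_false]
    constructor
    · rintro (⟨z, hz, h⟩ | ⟨z, hz, h⟩)
      · exact ⟨z, hz, Or.inl h.symm⟩
      · exact ⟨z, hz, Or.inr h.symm⟩
    · rintro ⟨z, hz, h | h⟩
      · exact Or.inl ⟨z, hz, h.symm⟩
      · exact Or.inr ⟨z, hz, h.symm⟩

theorem mem_radicalFinset {k : ℕ} {y : ℝ} : y ∈ radicalFinset k ↔ y ∈ nestedRadicals k := by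
  rw [← coe_radicalFinset, Finset.mem_coe]

theorem card_radicalFinset (k : ℕ) : (radicalFinset k).card = 2 ^ k := by
  induction k with
  | zero => simp [radicalFinset]
  | succ k ih =>
    have hgt : ∀ z ∈ radicalFinset k, -6 < z := fun z hz => by
      linarith [(mem_Ioo_of_mem_nestedRadicals (mem_radicalFinset.1 hz)).1]
    have hinj (b : Bool) : InjOn (branch b) (radicalFinset k) := fun z hz w hw h =>
      branch_injOn b (hgt z hz).le (hgt w hw).le h
    rw [radicalFinset, Finset.card_union_of_disjoint, Finset.card_image_of_injOn (hinj _),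
      Finset.card_image_of_injOn (hinj _), ih, pow_succ, mul_two]
    rw [Finset.disjoint_left]
    intro y h1 h2
    obtain ⟨z, hz, rfl⟩ := Finset.mem_image.1 h1
    obtain ⟨w, hw, h⟩ := Finset.mem_image.1 h2
    have h3 := (branch_pos_iff true (hgt z hz)).2 rfl
    rw [← h] at h3
    exact Bool.false_ne_true ((branch_pos_iff false (hgt w hw)).1 h3)

/-! ### The Julia set -/

theorem juliaSet_subset : juliaSet ⊆ Icc (-3 : ℝ) 3 := fun _ hy => hy 0

theorem mem_juliaSet_iff {y : ℝ} : y ∈ juliaSet ↔ y ∈ Icc (-3 : ℝ) 3 ∧ quadMap y ∈ juliaSet := by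
  refine ⟨fun h => ⟨h 0, fun n => ?_⟩, fun h n => ?_⟩
  · rw [← Function.iterate_succ_apply]
    exact h (n + 1)
  · cases n with
    | zero => exact h.1
    | succ n =>
      rw [Function.iterate_succ_apply]
      exact h.2 n

theorem iterate_mem_juliaSet {y : ℝ} (hy : y ∈ juliaSet) (n : ℕ) : quadMap^[n] y ∈ juliaSet := by
  intro m
  rw [← Function.iterate_add_apply]
  exact hy _

theorem branch_mem_juliaSet (b : Bool) {z : ℝ} (hz : z ∈ juliaSet) : branch b z ∈ juliaSet := by
  have := juliaSet_subset hz
  rw [mem_juliaSet_iff, quadMap_branch b (by linarith [this.1])]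
  exact ⟨branch_mem_Icc b this.2, hz⟩

theorem three_mem_juliaSet : (3 : ℝ) ∈ juliaSet := by
  intro n
  have : quadMap^[n] 3 = 3 := Function.iterate_fixed (by norm_num [quadMap]) n
  norm_num [this]

theorem zero_notMem_juliaSet : (0 : ℝ) ∉ juliaSet := fun h => by
  have := (h 1).1
  norm_num [quadMap] at this

theorem neg_mem_juliaSet {y : ℝ} (hy : y ∈ juliaSet) : -y ∈ juliaSet := by
  rw [mem_juliaSet_iff] at hy ⊢
  refine ⟨⟨by linarith [hy.1.2], by linarith [hy.1.1]⟩, ?_⟩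
  have : quadMap (-y) = quadMap y := by simp [quadMap]
  rw [this]
  exact hy.2

/-- Outside `[-3, 3]` the excess `|x| - 3` at least doubles at each step, since `x² - 9 = (|x| -
3)(|x| + 3)`; an orbit that leaves the interval is therefore unbounded. -/
theorem mem_juliaSet_of_bounded {y C : ℝ} (h : ∀ n, |quadMap^[n] y| ≤ C) : y ∈ juliaSet := by
  by_contra hy
  simp only [juliaSet, mem_ofPred_eq, not_forall, mem_Icc, ← abs_le, not_le] at hy
  obtain ⟨m, hm⟩ := hy
  have key : ∀ n, 2 ^ n * (|quadMap^[m] y| - 3) ≤ |quadMap^[n + m] y| - 3 := by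
    intro n
    induction n with
    | zero => simp
    | succ n ih =>
      rw [add_right_comm, Function.iterate_succ_apply']
      set x := quadMap^[n + m] y
      have h0 : 0 < |x| - 3 := lt_of_lt_of_le (by have := sub_pos.2 hm; positivity) ih
      have h1 : |x| ^ 2 - 6 ≤ |quadMap x| := by
        rw [sq_abs]
        exact le_abs_self _
      rw [pow_succ]
      nlinarith
  obtain ⟨n, hn⟩ := pow_unbounded_of_one_lt (C / (|quadMap^[m] y| - 3)) (one_lt_two (α := ℝ))
  rw [div_lt_iff₀ (sub_pos.2 hm)] at hn
  linarith [key n, h (n + m)]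

theorem isClosed_juliaSet : IsClosed juliaSet := by
  have : juliaSet = ⋂ n, quadMap^[n] ⁻¹' Icc (-3 : ℝ) 3 := by
    ext y
    simp [juliaSet]
  rw [this]
  exact isClosed_iInter fun n => isClosed_Icc.preimage (continuous_quadMap.iterate n)

theorem isCompact_juliaSet : IsCompact juliaSet :=
  isCompact_Icc.of_isClosed_subset isClosed_juliaSet juliaSet_subset

theorem juliaSet_eq_union : juliaSet = branch true '' juliaSet ∪ branch false '' juliaSet := by
  refine Subset.antisymm (fun y hy => ?_) (union_subset ?_ ?_)
  · have h := (mem_juliaSet_iff.1 hy).2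
    have := branch_quadMap y
    by_cases h0 : 0 < y
    · exact Or.inl ⟨_, h, by simpa [h0] using this⟩
    · exact Or.inr ⟨_, h, by simpa [h0] using this⟩
  all_goals
    rintro _ ⟨z, hz, rfl⟩
    exact branch_mem_juliaSet _ hz

/-- The set is the union of its two images under maps with Lipschitz constant `1/3`, so its finite
measure `v` satisfies `v ≤ (2/3) v`. -/
theorem volume_juliaSet : volume juliaSet = 0 := by
  have hlip (b : Bool) : volume (branch b '' juliaSet) ≤ (3 : ENNReal)⁻¹ * volume juliaSet := by
    have h : LipschitzOnWith (3⁻¹ : NNReal) (branch b) juliaSet :=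
      LipschitzOnWith.of_dist_le_mul fun z hz w hw => by
        rw [Real.dist_eq, Real.dist_eq]
        refine (abs_branch_sub_branch_le b (juliaSet_subset hz).1 (juliaSet_subset hw).1).trans ?_
        simp
    have := h.hausdorffMeasure_image_le zero_le_one
    rw [hausdorffMeasure_real] at this
    simpa using this
  have hfin : volume juliaSet ≠ ⊤ := isCompact_juliaSet.measure_lt_top.ne
  have h : volume juliaSet ≤ (3 : ENNReal)⁻¹ * volume juliaSet + (3 : ENNReal)⁻¹ * volume juliaSet := by
    conv_lhs => rw [juliaSet_eq_union]
    exact (measure_union_le _ _).trans (add_le_add (hlip _) (hlip _))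
  lift volume juliaSet to NNReal using hfin with v
  have h3 : (3 : ENNReal)⁻¹ = ((3⁻¹ : NNReal) : ENNReal) := by simp
  rw [h3] at h
  norm_cast at h ⊢
  have h' : (v : ℝ) ≤ 3⁻¹ * v + 3⁻¹ * v := by exact_mod_cast h
  have : (v : ℝ) = 0 := le_antisymm (by linarith) v.2
  exact_mod_cast this

/-! ### Symbolic coding -/

/-- The itinerary of a point of the Julia set. -/
noncomputable def itinerary (y : juliaSet) (n : ℕ) : Bool := decide (0 < quadMap^[n] y.1)

theorem continuous_itinerary : Continuous itinerary := by
  refine continuous_pi fun n => ?_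
  have hc : Continuous fun y : juliaSet => quadMap^[n] y.1 :=
    (continuous_quadMap.iterate n).comp continuous_subtype_val
  refine continuous_bool_rng true |>.2 ?_
  have : (fun y : juliaSet => itinerary y n) ⁻¹' {true} =
      (fun y : juliaSet => quadMap^[n] y.1) ⁻¹' Ioi 0 := by
    ext y
    simp [itinerary]
  rw [this]
  refine ⟨?_, isOpen_Ioi.preimage hc⟩
  -- Orbits in the Julia set avoid `0`, so positivity is also a closed condition.
  have h2 : (fun y : juliaSet => quadMap^[n] y.1) ⁻¹' Ioi 0 =
      (fun y : juliaSet => quadMap^[n] y.1) ⁻¹' Ici 0 := by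
    ext y
    rw [mem_preimage, mem_preimage, mem_Ioi, mem_Ici]
    refine ⟨le_of_lt, fun h => lt_of_le_of_ne h fun h0 => ?_⟩
    exact zero_notMem_juliaSet (h0 ▸ iterate_mem_juliaSet y.2 n)
  rw [h2]
  exact isClosed_Ici.preimage hc

/-- Points sharing `n` symbols are images, under one composition of `n` contracting branches, of two
points of `[-3, 3]`, an interval of length `6`. -/
theorem dist_le_of_itinerary {n : ℕ} {y z : ℝ} (hy : y ∈ juliaSet) (hz : z ∈ juliaSet)
    (h : ∀ i < n, itinerary ⟨y, hy⟩ i = itinerary ⟨z, hz⟩ i) : |y - z| ≤ (1 / 3) ^ n * 6 := by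
  induction n generalizing y z with
  | zero =>
    have h1 := juliaSet_subset hy
    have h2 := juliaSet_subset hz
    rw [abs_le]
    constructor <;> linarith [h1.1, h1.2, h2.1, h2.2]
  | succ n ih =>
    have hy' := (mem_juliaSet_iff.1 hy).2
    have hz' := (mem_juliaSet_iff.1 hz).2
    have h1 := ih hy' hz' fun i hi => h (i + 1) (by omega)
    have h0 : decide (0 < y) = decide (0 < z) := h 0 (by omega)
    rw [← branch_quadMap y, ← branch_quadMap z, h0]
    refine (abs_branch_sub_branch_le _ (juliaSet_subset hy').1 (juliaSet_subset hz').1).trans ?_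
    rw [pow_succ]
    linarith

theorem itinerary_injective : Function.Injective itinerary := by
  rintro ⟨y, hy⟩ ⟨z, hz⟩ h
  have h1 (n : ℕ) : |y - z| ≤ (1 / 3) ^ n * 6 :=
    dist_le_of_itinerary hy hz fun i _ => congrFun h i
  have h2 : Tendsto (fun n : ℕ => (1 / 3 : ℝ) ^ n * 6) atTop (𝓝 (0 * 6)) :=
    (tendsto_pow_atTop_nhds_zero_of_lt_one (by norm_num) (by norm_num)).mul_const 6
  have h3 := ge_of_tendsto' h2 h1
  rw [zero_mul] at h3
  exact Subtype.ext (sub_eq_zero.1 (abs_eq_zero.1 (le_antisymm h3 (abs_nonneg _))))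

theorem exists_itinerary_eq (b : ℕ → Bool) (n : ℕ) :
    ∃ y : juliaSet, ∀ i < n, itinerary y i = b i := by
  induction n generalizing b with
  | zero => exact ⟨⟨3, three_mem_juliaSet⟩, by simp⟩
  | succ n ih =>
    obtain ⟨⟨z, hz⟩, h⟩ := ih fun i => b (i + 1)
    have hz6 : -6 < z := by linarith [(juliaSet_subset hz).1]
    refine ⟨⟨branch (b 0) z, branch_mem_juliaSet _ hz⟩, fun i hi => ?_⟩
    cases i with
    | zero =>
      have := branch_pos_iff (b 0) hz6
      rw [itinerary, Function.iterate_zero, id, Bool.eq_iff_iff, decide_eq_true_iff, this]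
    | succ i =>
      rw [← h i (by omega), itinerary, itinerary, Function.iterate_succ_apply,
        quadMap_branch _ hz6.le]

/-- Every finite word is realised by pulling back `3` along branches, so the range is dense; it is
closed by compactness. -/
theorem itinerary_surjective : Function.Surjective itinerary := by
  have : CompactSpace juliaSet := isCompact_iff_compactSpace.1 isCompact_juliaSet
  have hcl : IsClosed (range itinerary) := (isCompact_range continuous_itinerary).isClosed
  rw [← range_eq_univ, ← hcl.closure_eq]
  refine eq_univ_of_forall fun b => ?_
  choose y hy using exists_itinerary_eq b
  refine mem_closure_of_tendsto (f := fun n => itinerary (y n)) (b := atTop) ?_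
    (Eventually.of_forall fun n => mem_range_self _)
  refine tendsto_pi_nhds.2 fun i => tendsto_const_nhds.congr' ?_
  filter_upwards [eventually_gt_atTop i] with n hn
  exact (hy n i hn).symm

theorem nonempty_juliaSet_homeomorph : Nonempty (juliaSet ≃ₜ (ℕ → Bool)) := by
  have : CompactSpace juliaSet := isCompact_iff_compactSpace.1 isCompact_juliaSet
  exact ⟨Continuous.homeoOfEquivCompactToT2
    (f := Equiv.ofBijective itinerary ⟨itinerary_injective, itinerary_surjective⟩)
    continuous_itinerary⟩

/-! ### Accumulation points of the nested radicals -/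

theorem notMem_juliaSet_of_mem_nestedRadicals {k : ℕ} {y : ℝ} (hy : y ∈ nestedRadicals k) :
    y ∉ juliaSet := fun h =>
  zero_notMem_juliaSet (mem_nestedRadicals_iff.1 hy ▸ iterate_mem_juliaSet h k)

/-- Apply the `n` branches that recover `y` from `quadMap^[n] y` to `0` instead; the initial error
is at most `3`. -/
theorem exists_nestedRadicals_near {n : ℕ} {y : ℝ} (hy : y ∈ juliaSet) :
    ∃ z ∈ nestedRadicals n, |y - z| ≤ (1 / 3) ^ n * 3 := by
  induction n generalizing y with
  | zero => exact ⟨0, rfl, by simpa [abs_le] using juliaSet_subset hy⟩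
  | succ n ih =>
    have hy' := (mem_juliaSet_iff.1 hy).2
    obtain ⟨z, hz, h⟩ := ih hy'
    have hz3 := (mem_Ioo_of_mem_nestedRadicals hz).1.le
    refine ⟨branch (decide (0 < y)) z, ?_, ?_⟩
    · rwa [mem_nestedRadicals_succ, quadMap_branch _ (by linarith)]
    · have := abs_branch_sub_branch_le (decide (0 < y)) (juliaSet_subset hy').1 hz3
      rw [branch_quadMap] at this
      rw [pow_succ]
      linarith

theorem derivedSet_nestedRadicals : derivedSet (⋃ k, nestedRadicals k) = juliaSet := by
  refine Subset.antisymm (fun y hy => ?_) fun y hy => ?_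
  · by_contra hJ
    simp only [juliaSet, mem_ofPred_eq, not_forall] at hJ
    obtain ⟨n, hn⟩ := hJ
    rw [mem_derivedSet, accPt_iff_frequently] at hy
    -- The orbit of `y` leaves `[-3, 3]` at time `n`, and so do nearby orbits. A radical of depth at
    -- least `n` has its `n`-th iterate in `(-3, 3)`, so only the finitely many of depth below `n`
    -- can occur near `y`.
    have hU : ∀ᶠ z in 𝓝 y, quadMap^[n] z ∉ Icc (-3 : ℝ) 3 :=
      (continuous_quadMap.iterate n).continuousAt.eventually
        (isClosed_Icc.isOpen_compl.mem_nhds hn)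
    have hfin : (⋃ k ∈ Finset.range n, (radicalFinset k : Set ℝ)).Finite :=
      (Finset.finite_toSet _).biUnion fun k _ => Finset.finite_toSet _
    have hV : ∀ᶠ z in 𝓝 y, z ∉ (⋃ k ∈ Finset.range n, (radicalFinset k : Set ℝ)) \ {y} :=
      (hfin.subset sdiff_subset).isClosed.isOpen_compl.mem_nhds (by simp)
    obtain ⟨z, ⟨hzy, hz⟩, hzU, hzV⟩ := (hy.and_eventually (hU.and hV)).exists
    obtain ⟨k, hk⟩ := mem_iUnion.1 hz
    rcases lt_or_ge k n with hkn | hkn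
    · refine hzV ⟨mem_iUnion₂.2 ⟨k, Finset.mem_range.2 hkn, ?_⟩, hzy⟩
      rwa [coe_radicalFinset]
    · obtain ⟨m, rfl⟩ := Nat.exists_eq_add_of_le hkn
      refine hzU (Ioo_subset_Icc_self (mem_Ioo_of_mem_nestedRadicals (k := m) ?_))
      rw [mem_nestedRadicals_iff, ← Function.iterate_add_apply, add_comm]
      exact mem_nestedRadicals_iff.1 hk
  · rw [mem_derivedSet, accPt_iff_frequently]
    choose z hz hyz using fun n => exists_nestedRadicals_near (n := n) hy
    have h2 : Tendsto (fun n : ℕ => (1 / 3 : ℝ) ^ n * 3) atTop (𝓝 0) := by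
      simpa using (tendsto_pow_atTop_nhds_zero_of_lt_one (r := (1 / 3 : ℝ)) (by norm_num)
        (by norm_num)).mul_const 3
    have h3 : Tendsto z atTop (𝓝 y) := by
      rw [tendsto_iff_dist_tendsto_zero]
      refine squeeze_zero (fun _ => dist_nonneg) (fun n => ?_) h2
      rw [dist_comm, Real.dist_eq]
      exact hyz n
    refine h3.frequently (Frequently.of_forall fun n => ⟨?_, mem_iUnion.2 ⟨n, hz n⟩⟩)
    rintro h
    exact notMem_juliaSet_of_mem_nestedRadicals (hz n) (h ▸ hy)

theorem closure_nestedRadicals :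
    closure (⋃ k, nestedRadicals k) = juliaSet ∪ ⋃ k, nestedRadicals k := by
  rw [closure_eq_self_union_derivedSet, derivedSet_nestedRadicals, union_comm]

/-- An orbit starting in `S` can be stopped only by reaching `0`; otherwise it remains in the
bounded set `S` forever. -/
theorem subset_union_of_bounded_invariant {S : Set ℝ} {C : ℝ} (hC : ∀ y ∈ S, |y| ≤ C)
    (hS : ∀ y ∈ S, y = 0 ∨ quadMap y ∈ S) : S ⊆ juliaSet ∪ ⋃ k, nestedRadicals k := by
  intro y hy
  by_cases h : ∃ k, y ∈ nestedRadicals k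
  · exact Or.inr (mem_iUnion.2 h)
  · left
    simp only [mem_nestedRadicals_iff, not_exists] at h
    have hn : ∀ n, quadMap^[n] y ∈ S := by
      intro n
      induction n with
      | zero => exact hy
      | succ n ih =>
        rw [Function.iterate_succ_apply']
        exact (hS _ ih).resolve_left (h n)
    exact mem_juliaSet_of_bounded fun n => hC _ (hn n)

end FabrykowskiGupta

/-! ### Linear algebra of the renormalization -/

section Renormalization

variable {k V W : Type*} [Field k] [AddCommGroup V] [Module k V] [AddCommGroup W]
  [Module k W] {A S : V →ₗ[k] V} {ι : W →ₗ[k] V} {N : W →ₗ[k] W}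

theorem renormalization_eigenvector (hι : ∀ f, A (ι f) = (3 : k) • ι f)
    (hS : ∀ v, S (S v) = (3 : k) • S v) (hAS : ∀ f, A (S (ι f)) = ι (N f) + (6 : k) • ι f)
    {z : k} {f : W} (hf : N f = (z ^ 2 - 6) • f) :
    A (S (ι f) + z • ι f) + S (S (ι f) + z • ι f) - (3 : k) • (S (ι f) + z • ι f) =
      z • (S (ι f) + z • ι f) := by
  simp only [map_add, map_smul, hι, hS, hAS, hf]
  module

/-- The eigenvalues of `S` lie in `{0, 3}`. Applying `S` to `Sιf + zιf = 0` gives `(3 + z)Sιf = 0`,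
and then `zιf = 0`. -/
theorem renormalization_injective (hinj : Function.Injective ι)
    (hS : ∀ v, S (S v) = (3 : k) • S v) {z : k} (h0 : z ≠ 0) (h3 : z ≠ -3) :
    Function.Injective (S ∘ₗ ι + z • ι) := by
  rw [← LinearMap.ker_eq_bot, LinearMap.ker_eq_bot']
  intro f hf
  change S (ι f) + z • ι f = 0 at hf
  have h1 : (3 + z) • S (ι f) = 0 := by
    have := congrArg S hf
    simp only [map_add, map_smul, hS, map_zero] at this
    rw [add_smul, this]
  have h2 : S (ι f) = 0 := (smul_eq_zero.1 h1).resolve_left fun h => h3 (by linear_combination h)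
  rw [h2, zero_add] at hf
  exact hinj (((smul_eq_zero.1 hf).resolve_left h0).trans (map_zero ι).symm)

/-- This is the resolvent form of the correspondence `z ↦ z² - 6`. It is purely algebraic, so it
also covers spectral values that are not eigenvalues. -/
theorem renormalization_bijective (hι : ∀ f, A (ι f) = (3 : k) • ι f)
    (hA : ∀ v, A (A v) = (3 : k) • A v)
    (hS : ∀ v, S (S v) = (3 : k) • S v) (hAS : ∀ f, A (S (ι f)) = ι (N f) + (6 : k) • ι f)
    (hinj : Function.Injective ι) (hr : ∀ v, ∃ f, A v = ι f) {z : k} (h0 : z ≠ 0) (h3 : z ≠ -3)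
    (hN : Function.Bijective ⇑(N - (z ^ 2 - 6) • (LinearMap.id : W →ₗ[k] W))) :
    Function.Bijective ⇑(A + S - (3 : k) • (LinearMap.id : V →ₗ[k] V) - z • (LinearMap.id : V →ₗ[k] V)) := by
  have h3' : 3 + z ≠ 0 := fun h => h3 (by linear_combination h)
  constructor
  · rw [← LinearMap.ker_eq_bot, LinearMap.ker_eq_bot']
    intro v hv
    change A v + S v - (3 : k) • v - z • v = 0 at hv
    have e1 : A (S v) = z • A v := by
      have := congrArg A hv
      simp only [map_add, map_sub, map_smul, hA, map_zero] at this
      linear_combination (norm := module) this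
    have e2 : S (A v) = z • S v := by
      have := congrArg S hv
      simp only [map_add, map_sub, map_smul, hS, map_zero] at this
      linear_combination (norm := module) this
    obtain ⟨g, hg⟩ := hr v
    have e3 : ι (N g - (z ^ 2 - 6) • g) = 0 := by
      -- With `A v = ι g`, this identity says that `g` is an eigenvector of `N` for `z ^ 2 - 6`,
      -- hence zero.
      have h : A (S (A v)) = (z ^ 2) • A v := by rw [e2, map_smul, e1, smul_smul, pow_two]
      rw [hg, hAS] at h
      rw [map_sub, map_smul, sub_smul, ← h]
      abel
    have e4 : g = 0 := hN.1 (by rw [map_zero]; exact hinj (e3.trans (map_zero ι).symm))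
    rw [e4, map_zero] at hg
    rw [hg, map_zero] at e2
    have e5 : S v = 0 := (smul_eq_zero.1 e2.symm).resolve_left h0
    rw [hg, e5] at hv
    refine (smul_eq_zero.1 (?_ : (3 + z) • v = 0)).resolve_left h3'
    linear_combination (norm := module) -hv
  -- First hit the range of `ι`, using the trial vector that produces eigenvectors.
  · have hι_range : ∀ g, ∃ x, A x + S x - (3 : k) • x - z • x = ι g := by
      intro g
      obtain ⟨h, rfl⟩ := hN.2 g
      refine ⟨S (ι h) + z • ι h, ?_⟩
      simp only [map_add, map_smul, hι, hS, hAS, map_sub, LinearMap.sub_apply,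
        LinearMap.smul_apply, LinearMap.id_apply]
      module
    intro w
    -- Because `S² = 3S`, this solves `(S - 3 - z)x = w` explicitly. The remaining error `A x` lies
    -- in the range of `ι` and is corrected by `y`.
    set x := (-(3 + z)⁻¹) • (w + z⁻¹ • S w) with hx
    have e1 : S x - (3 : k) • x - z • x = w := by
      simp only [hx, map_add, map_smul, hS]
      match_scalars <;> field_simp <;> ring
    obtain ⟨g, hg⟩ := hr x
    obtain ⟨y, hy⟩ := hι_range g
    refine ⟨x - y, ?_⟩
    change A (x - y) + S (x - y) - (3 : k) • (x - y) - z • (x - y) = w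
    simp only [map_sub, smul_sub]
    linear_combination (norm := module) e1 - hy + hg

theorem one_add_add_mul_self {R : Type*} [Ring R] {T T' : R} (h1 : T * T = T')
    (h2 : T' * T' = T) (h3 : T * T' = 1) (h4 : T' * T = 1) :
    (1 + T + T') * (1 + T + T') = 3 * (1 + T + T') := by
  have : (1 + T + T') * (1 + T + T') =
      1 + 2 * T + 2 * T' + T * T + T' * T' + T * T' + T' * T := by noncomm_ring
  rw [this, h1, h2, h3, h4]
  noncomm_ring

end Renormalization

/-! ### The action on the boundary, letter by letter -/

namespace TernaryTree

/-- The boundary point `x ξ`. -/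
def consB (x : Fin 3) (ξ : Boundary) : Boundary
  | 0 => x
  | n + 1 => ξ n

/-- Deletion of the first letter. -/
def shift (ξ : Boundary) : Boundary := fun n => ξ (n + 1)

theorem consB_shift (ξ : Boundary) : consB (ξ 0) (shift ξ) = ξ := by
  funext n
  cases n <;> rfl

theorem shift_consB (x : Fin 3) (ξ : Boundary) : shift (consB x ξ) = ξ := rfl

theorem pref_consB_succ (x : Fin 3) (ξ : Boundary) (n : ℕ) :
    pref (consB x ξ) (n + 1) = x :: pref ξ n := by
  simp [pref, List.ofFn_succ, consB]

theorem act_consB {g : Aut} {x y : Fin 3} {ξ η : Boundary}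
    (h : ∀ n, g.1 (x :: pref ξ n) = y :: pref η n) : act g (consB x ξ) = consB y η := by
  refine eq_of_pref fun n => ?_
  rw [pref_act]
  cases n with
  | zero => exact Aut.map_nil g
  | succ n => rw [pref_consB_succ, pref_consB_succ, h]

theorem measurable_shift : Measurable shift :=
  measurable_pi_lambda _ fun n => measurable_pi_apply (n + 1)

theorem measurable_consB (x : Fin 3) : Measurable (consB x) :=
  measurable_pi_lambda _ fun n => by
    cases n with
    | zero => exact measurable_const
    | succ n => exact measurable_pi_apply n

theorem measurePreserving_shift : MeasurePreserving shift bernoulli bernoulli := by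
  refine ⟨measurable_shift, ?_⟩
  conv_rhs => rw [bernoulli]
  refine Measure.eq_infinitePi _ fun s t ht => ?_
  rw [Measure.map_apply measurable_shift (MeasurableSet.pi s.countable_toSet fun i _ => ht i)]
  have h : shift ⁻¹' Set.pi s t =
      Set.pi (s.map (addRightEmbedding 1) : Finset ℕ) fun i => t (i - 1) := by
    ext ξ
    simp [Set.mem_pi, shift]
  rw [h, bernoulli, Measure.infinitePi_pi _ fun i _ => ht _]
  simp

/-- The sum `1 + g + g⁻¹` acting in `L²` of the boundary. -/
noncomputable def orbitSum (g : Aut) : L2Boundary →ₗ[ℂ] L2Boundary :=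
  1 + (translate g).toLinearMap + (translate g⁻¹).toLinearMap

theorem orbitSum_apply (g : Aut) (f : L2Boundary) :
    orbitSum g f = f + translate g f + translate g⁻¹ f := rfl

/-- The isometry of `L²` of the boundary given by composition with the shift. -/
noncomputable def shiftIso : L2Boundary →ₗᵢ[ℂ] L2Boundary :=
  Lp.compMeasurePreservingₗᵢ ℂ shift measurePreserving_shift

/-- Replaces an `L²` class by any representative `F`, so that the operator identities reduce to
pointwise computations on letters. -/
theorem orbitSum_ae {g : Aut} {f : L2Boundary} {F : Boundary → ℂ} (h : f =ᵐ[bernoulli] F) :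
    orbitSum g f =ᵐ[bernoulli] fun ξ => F ξ + F (act g⁻¹ ξ) + F (act g ξ) := by
  have h1 := (translate_coeFn g f).trans
    ((measurePreserving_act g⁻¹).quasiMeasurePreserving.ae h)
  have h2 := (translate_coeFn g⁻¹ f).trans
    ((measurePreserving_act g⁻¹⁻¹).quasiMeasurePreserving.ae h)
  rw [orbitSum_apply]
  filter_upwards [h, h1, h2, Lp.coeFn_add (f + translate g f) (translate g⁻¹ f),
    Lp.coeFn_add f (translate g f)] with ξ e1 e2 e3 e4 e5
  rw [e4, Pi.add_apply, e5, Pi.add_apply, e1, e2, e3, inv_inv]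

theorem shiftIso_ae {f : L2Boundary} {F : Boundary → ℂ} (h : f =ᵐ[bernoulli] F) :
    shiftIso f =ᵐ[bernoulli] fun ξ => F (shift ξ) :=
  (Lp.coeFn_compMeasurePreserving f measurePreserving_shift).trans
    (measurePreserving_shift.quasiMeasurePreserving.ae h)

theorem orbitSum_orbitSum {g : Aut} (hg : g * g = g⁻¹) (f : L2Boundary) :
    orbitSum g (orbitSum g f) = (3 : ℂ) • orbitSum g f := by
  have e : g⁻¹ * g⁻¹ = g := by rw [← mul_inv_rev, hg, inv_inv]
  have h := one_add_add_mul_self (R := L2Boundary →ₗ[ℂ] L2Boundary)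
    (T := (translate g).toLinearMap) (T' := (translate g⁻¹).toLinearMap)
    (LinearMap.ext fun f => by
      change translate g (translate g f) = translate g⁻¹ f
      rw [← translate_mul, hg])
    (LinearMap.ext fun f => by
      change translate g⁻¹ (translate g⁻¹ f) = translate g f
      rw [← translate_mul, e])
    (LinearMap.ext fun f => by
      change translate g (translate g⁻¹ f) = f
      rw [← translate_mul, mul_inv_cancel, translate_one])
    (LinearMap.ext fun f => by
      change translate g⁻¹ (translate g f) = f
      rw [← translate_mul, inv_mul_cancel, translate_one])
  have h' := congrArg (fun T : L2Boundary →ₗ[ℂ] L2Boundary => T f) h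
  refine h'.trans ?_
  change ((3 : L2Boundary →ₗ[ℂ] L2Boundary) * orbitSum g) f = _
  rw [Module.End.mul_apply, Module.End.ofNat_apply]
  exact (ofNat_smul_eq_nsmul ℂ 3 _).symm

end TernaryTree

/-! ### The action of `a` and `s` on the boundary -/

namespace FabrykowskiGupta

open TernaryTree

theorem a_mul_self : a * a = a⁻¹ := by
  refine Subtype.ext (Equiv.ext fun v => ?_)
  change rotFun 1 (rotFun 1 v) = rotFun (-1) v
  cases v with
  | nil => rfl
  | cons x σ =>
    simp only [rotFun, add_assoc]
    rfl

theorem s_mul_self : s * s = s⁻¹ := by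
  refine Subtype.ext (Equiv.ext fun v => ?_)
  change dirFun 1 (dirFun 1 v) = dirFun (-1) v
  induction v with
  | nil => rfl
  | cons x σ ih =>
    fin_cases x
    · exact congrArg (List.cons 0) (DFunLike.congr_fun (congrArg Subtype.val a_mul_self) σ)
    · rfl
    · exact congrArg (List.cons 2) ih

theorem act_a_consB (x : Fin 3) (ξ : Boundary) : act a (consB x ξ) = consB (x + 1) ξ :=
  act_consB fun _ => rfl

theorem act_a_inv_consB (x : Fin 3) (ξ : Boundary) : act a⁻¹ (consB x ξ) = consB (x + -1) ξ :=
  act_consB fun _ => rfl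

theorem act_s_consB_zero (ξ : Boundary) : act s (consB 0 ξ) = consB 0 (act a ξ) :=
  act_consB fun n => by rw [pref_act]; rfl

theorem act_s_inv_consB_zero (ξ : Boundary) : act s⁻¹ (consB 0 ξ) = consB 0 (act a⁻¹ ξ) :=
  act_consB fun n => by rw [pref_act]; rfl

theorem act_s_consB_one (ξ : Boundary) : act s (consB 1 ξ) = consB 1 ξ :=
  act_consB fun _ => rfl

theorem act_s_inv_consB_one (ξ : Boundary) : act s⁻¹ (consB 1 ξ) = consB 1 ξ :=
  act_consB fun _ => rfl

theorem act_s_consB_two (ξ : Boundary) : act s (consB 2 ξ) = consB 2 (act s ξ) :=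
  act_consB fun n => by rw [pref_act]; rfl

theorem act_s_inv_consB_two (ξ : Boundary) : act s⁻¹ (consB 2 ξ) = consB 2 (act s⁻¹ ξ) :=
  act_consB fun n => by rw [pref_act]; rfl

/-- The `a`-orbit of a point runs once through the three choices of first letter, so the sum depends
only on the tail. -/
theorem sum_act_a {E : Type*} [AddCommMonoid E] (F : Boundary → E) (ξ : Boundary) :
    F ξ + F (act a⁻¹ ξ) + F (act a ξ) =
      F (consB 0 (shift ξ)) + F (consB 1 (shift ξ)) + F (consB 2 (shift ξ)) := by
  obtain ⟨x, η, rfl⟩ : ∃ x η, ξ = consB x η := ⟨_, _, (consB_shift ξ).symm⟩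
  rw [act_a_consB, act_a_inv_consB, shift_consB]
  fin_cases x
  · change F (consB 0 η) + F (consB 2 η) + F (consB 1 η) = _
    abel
  · change F (consB 1 η) + F (consB 0 η) + F (consB 2 η) = _
    abel
  · change F (consB 2 η) + F (consB 1 η) + F (consB 0 η) = _
    abel

/-! ### Renormalization in `L²` of the boundary -/

theorem orbitSum_a_shiftIso (f : L2Boundary) : orbitSum a (shiftIso f) = (3 : ℂ) • shiftIso f := by
  have h := shiftIso_ae (EventuallyEq.refl _ f)
  refine Lp.ext ((orbitSum_ae h).trans ?_)
  filter_upwards [h, Lp.coeFn_smul (3 : ℂ) (shiftIso f)] with ξ e1 e2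
  rw [e2, Pi.smul_apply, e1, sum_act_a fun ξ => f (shift ξ)]
  simp only [shift_consB, smul_eq_mul]
  ring

/-- Over the first letters `0`, `1`, `2`, the function `S(ιf)` restricts to `Af`, `3f`, `Sf`, and
`A` adds these up. The `6` is the `3` from the letter `1` plus the `3` that compensates the
centering. -/
theorem orbitSum_a_orbitSum_s_shiftIso (f : L2Boundary) :
    orbitSum a (orbitSum s (shiftIso f)) =
      shiftIso (orbitSum a f + orbitSum s f - (3 : ℂ) • f) + (6 : ℂ) • shiftIso f := by
  have h0 := EventuallyEq.refl (ae TernaryTree.bernoulli) f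
  have h1 := orbitSum_ae (g := a) (orbitSum_ae (g := s) (shiftIso_ae h0))
  have h2 : (orbitSum a f + orbitSum s f - (3 : ℂ) • f : L2Boundary) =ᵐ[TernaryTree.bernoulli]
      fun ξ => (f ξ + f (act a⁻¹ ξ) + f (act a ξ)) + (f ξ + f (act s⁻¹ ξ) + f (act s ξ)) -
        3 * f ξ := by
    filter_upwards [orbitSum_ae (g := a) h0, orbitSum_ae (g := s) h0,
      Lp.coeFn_sub (orbitSum a f + orbitSum s f) ((3 : ℂ) • f),
      Lp.coeFn_add (orbitSum a f) (orbitSum s f), Lp.coeFn_smul (3 : ℂ) f] with ξ e1 e2 e3 e4 e5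
    rw [e3, Pi.sub_apply, e4, e5, Pi.add_apply, e1, e2]
    rfl
  refine Lp.ext (h1.trans ?_)
  filter_upwards [shiftIso_ae h2, shiftIso_ae h0, Lp.coeFn_smul (6 : ℂ) (shiftIso f),
    Lp.coeFn_add (shiftIso (orbitSum a f + orbitSum s f - (3 : ℂ) • f))
      ((6 : ℂ) • shiftIso f)] with ξ e1 e2 e3 e4
  rw [e4, Pi.add_apply, e3, Pi.smul_apply, e1, e2,
    sum_act_a fun ξ => f (shift ξ) + f (shift (act s⁻¹ ξ)) + f (shift (act s ξ))]
  simp only [act_s_consB_zero, act_s_consB_one, act_s_consB_two, act_s_inv_consB_zero,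
    act_s_inv_consB_one, act_s_inv_consB_two, shift_consB, smul_eq_mul]
  ring

theorem exists_orbitSum_a_eq_shiftIso (f : L2Boundary) : ∃ g, orbitSum a f = shiftIso g := by
  -- `G` is formed from the chosen measurable representative of `f`: each `consB x` has null image
  -- cylinder complement only in its own letter, so composition is done on functions and
  -- square-integrability is recovered from `G ∘ shift`.
  set G : Boundary → ℂ := fun η => f (consB 0 η) + f (consB 1 η) + f (consB 2 η) with hG
  have hm (x : Fin 3) : StronglyMeasurable fun η => f (consB x η) :=
    (Lp.stronglyMeasurable f).comp_measurable (measurable_consB x)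
  have hGm : StronglyMeasurable G := ((hm 0).add (hm 1)).add (hm 2)
  have h1 : orbitSum a f =ᵐ[TernaryTree.bernoulli] G ∘ shift :=
    (orbitSum_ae (EventuallyEq.refl _ f)).trans (Eventually.of_forall fun ξ => sum_act_a f ξ)
  have hL : MemLp G 2 TernaryTree.bernoulli := by
    have h := (memLp_congr_ae h1).1 (Lp.memLp (orbitSum a f))
    refine ⟨hGm.aestronglyMeasurable, ?_⟩
    rw [← eLpNorm_comp_measurePreserving hGm.aestronglyMeasurable measurePreserving_shift]
    exact h.2
  exact ⟨hL.toLp G, Lp.ext (h1.trans (shiftIso_ae hL.coeFn_toLp).symm)⟩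

/-- The function on the boundary determined by a function of the first letter. -/
noncomputable def firstLetter (c : Fin 3 → ℂ) : L2Boundary :=
  MemLp.toLp (fun ξ : Boundary => c (ξ 0)) <| MemLp.of_bound
    ((measurable_of_countable c).comp (measurable_pi_apply 0)).aestronglyMeasurable ‖c‖
    (Eventually.of_forall fun ξ => norm_le_pi_norm c (ξ 0))

theorem firstLetter_ae (c : Fin 3 → ℂ) :
    firstLetter c =ᵐ[TernaryTree.bernoulli] fun ξ => c (ξ 0) := MemLp.coeFn_toLp _

theorem firstLetter_ne_zero {c : Fin 3 → ℂ} (hc : c 0 ≠ 0) : firstLetter c ≠ 0 := by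
  intro h
  have h1 := firstLetter_ae c
  rw [h] at h1
  have h2 := h1.symm.trans (Lp.coeFn_zero ℂ 2 TernaryTree.bernoulli)
  have h3 : TernaryTree.bernoulli {ξ | pref ξ [(0 : Fin 3)].length = [0]} = 0 := by
    refine measure_mono_null (fun ξ hξ => ?_) (ae_iff.1 h2)
    have h0 : ξ 0 = 0 := by simpa [pref] using hξ
    simpa [h0] using hc
  rw [bernoulli_cylinder] at h3
  simp at h3

theorem orbitSum_s_firstLetter (c : Fin 3 → ℂ) :
    orbitSum s (firstLetter c) = (3 : ℂ) • firstLetter c := by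
  refine Lp.ext ((orbitSum_ae (firstLetter_ae c)).trans ?_)
  filter_upwards [firstLetter_ae c, Lp.coeFn_smul (3 : ℂ) (firstLetter c)] with ξ e1 e2
  rw [e2, Pi.smul_apply, e1]
  have h (g : Aut) (hg : ∀ x, g.1 [x] = [x]) : act g ξ 0 = ξ 0 := by
    have := pref_act g ξ 1
    simpa [pref, hg] using this
  rw [h s fun x => by fin_cases x <;> rfl, h s⁻¹ fun x => by fin_cases x <;> rfl, smul_eq_mul]
  ring

theorem orbitSum_a_firstLetter (c : Fin 3 → ℂ) :
    orbitSum a (firstLetter c) = firstLetter fun _ => c 0 + c 1 + c 2 := by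
  refine Lp.ext ((orbitSum_ae (firstLetter_ae c)).trans ?_)
  filter_upwards [firstLetter_ae fun _ => c 0 + c 1 + c 2] with ξ e1
  rw [e1, sum_act_a fun ξ => c (ξ 0)]
  rfl

end FabrykowskiGupta

/-! ### Hecke type operators -/

theorem heckeOperator_apply {G H : Type*} [Group G] [NormedAddCommGroup H]
    [InnerProductSpace ℂ H] (τ : G →* (H ≃ₗᵢ[ℂ] H)) (S : Finset G) (x : H) :
    heckeOperator τ S x = ∑ g ∈ S, τ g x := by
  simp [heckeOperator]

theorem heckeOperator_isSelfAdjoint {G H : Type*} [Group G] [NormedAddCommGroup H]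
    [InnerProductSpace ℂ H] [CompleteSpace H] (τ : G →* (H ≃ₗᵢ[ℂ] H)) {S : Finset G}
    (hS : ∀ g ∈ S, g⁻¹ ∈ S) : IsSelfAdjoint (heckeOperator τ S) := by
  rw [ContinuousLinearMap.isSelfAdjoint_iff_isSymmetric]
  intro x y
  change inner ℂ (heckeOperator τ S x) y = inner ℂ x (heckeOperator τ S y)
  rw [heckeOperator_apply, heckeOperator_apply, sum_inner, inner_sum]
  refine Finset.sum_nbij' (fun g => g⁻¹) (fun g => g⁻¹) hS hS (fun g _ => inv_inv g)
    (fun g _ => inv_inv g) fun g _ => ?_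
  rw [← (τ g).inner_map_map x (τ g⁻¹ y)]
  congr 1
  change y = (τ g * τ g⁻¹) y
  rw [← map_mul, mul_inv_cancel, map_one]
  rfl

/-! ### The spectrum of the boundary representation -/

namespace FabrykowskiGupta

open TernaryTree

theorem sum_gens {M : Type*} [AddCommMonoid M] (φ : Gam → M) :
    ∑ g ∈ gens, φ g = φ aG + φ aG⁻¹ + φ sG + φ sG⁻¹ := by
  classical
  have hne {g h : Gam} (H : g.1.1 [0, 0] ≠ h.1.1 [0, 0]) : g ≠ h := fun e => H (e ▸ rfl)
  have e1 : aG.1.1 [0, 0] = [1, 0] := rfl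
  have e2 : aG⁻¹.1.1 [0, 0] = [2, 0] := rfl
  have e3 : sG.1.1 [0, 0] = [0, 1] := rfl
  have e4 : sG⁻¹.1.1 [0, 0] = [0, 2] := rfl
  have h12 : aG ≠ aG⁻¹ := hne (by rw [e1, e2]; decide)
  have h13 : aG ≠ sG := hne (by rw [e1, e3]; decide)
  have h14 : aG ≠ sG⁻¹ := hne (by rw [e1, e4]; decide)
  have h23 : aG⁻¹ ≠ sG := hne (by rw [e2, e3]; decide)
  have h24 : aG⁻¹ ≠ sG⁻¹ := hne (by rw [e2, e4]; decide)
  have h34 : sG ≠ sG⁻¹ := hne (by rw [e3, e4]; decide)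
  rw [gens, Finset.sum_insert (by simp [h12, h13, h14]), Finset.sum_insert (by simp [h23, h24]),
    Finset.sum_insert (by simp [h34]), Finset.sum_singleton]
  abel

theorem heckeOperator_rep_apply (f : L2Boundary) :
    heckeOperator rep gens f = orbitSum a f + orbitSum s f - (2 : ℂ) • f := by
  rw [heckeOperator_apply, sum_gens]
  change translate a f + translate a⁻¹ f + translate s f + translate s⁻¹ f = _
  rw [orbitSum_apply, orbitSum_apply]
  module

/-- The operator `Δ - 1` in `L²` of the boundary. -/
noncomputable def centeredOp : L2Boundary →ₗ[ℂ] L2Boundary :=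
  orbitSum a + orbitSum s - (3 : ℂ) • LinearMap.id

theorem centeredOp_apply (f : L2Boundary) :
    centeredOp f = orbitSum a f + orbitSum s f - (3 : ℂ) • f := rfl

/-- A bounded bijection of a Banach space has a bounded inverse, so spectrum membership becomes a
statement of linear algebra. -/
theorem one_add_mem_repSpectrum_iff (z : ℂ) :
    1 + z ∈ repSpectrum rep gens ↔
      ¬ Function.Bijective ⇑(centeredOp - z • (LinearMap.id : L2Boundary →ₗ[ℂ] L2Boundary)) := by
  rw [repSpectrum, spectrum.mem_iff, ← IsUnit.neg_iff, ContinuousLinearMap.isUnit_iff_bijective]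
  refine not_congr (iff_of_eq (congrArg _ (funext fun f => ?_)))
  change -((1 + z) • f - heckeOperator rep gens f) = centeredOp f - z • f
  rw [heckeOperator_rep_apply, centeredOp_apply]
  module

theorem sq_sub_six_mem_repSpectrum {z : ℂ} (h : 1 + z ∈ repSpectrum rep gens) (h0 : z ≠ 0)
    (h3 : z ≠ -3) : 1 + (z ^ 2 - 6) ∈ repSpectrum rep gens := by
  rw [one_add_mem_repSpectrum_iff] at h ⊢
  exact fun hN => h <| renormalization_bijective (ι := shiftIso.toLinearMap) (N := centeredOp)
    orbitSum_a_shiftIso (orbitSum_orbitSum a_mul_self) (orbitSum_orbitSum s_mul_self)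
    orbitSum_a_orbitSum_s_shiftIso shiftIso.injective exists_orbitSum_a_eq_shiftIso h0 h3 hN

theorem one_add_mem_repSpectrum_of_eigenvector {z : ℂ} {f : L2Boundary} (hf : f ≠ 0)
    (h : centeredOp f = z • f) : 1 + z ∈ repSpectrum rep gens := by
  rw [one_add_mem_repSpectrum_iff]
  intro hb
  refine hf (hb.1 ?_)
  rw [map_zero, LinearMap.sub_apply, h]
  exact sub_self _

theorem centeredOp_firstLetter (c : Fin 3 → ℂ) :
    centeredOp (firstLetter c) = firstLetter fun _ => c 0 + c 1 + c 2 := by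
  rw [centeredOp_apply, orbitSum_a_firstLetter, orbitSum_s_firstLetter, add_sub_cancel_right]

theorem firstLetter_const (z : ℂ) : (firstLetter fun _ => z) = z • firstLetter fun _ => 1 := by
  refine Lp.ext ((firstLetter_ae _).trans ?_)
  filter_upwards [firstLetter_ae fun _ => 1, Lp.coeFn_smul z (firstLetter fun _ => 1)]
    with ξ e1 e2
  rw [e2, Pi.smul_apply, e1, smul_eq_mul, mul_one]

theorem exists_eigenvector_of_mem_nestedRadicals {k : ℕ} {y : ℝ} (hy : y ∈ nestedRadicals k) :
    ∃ f : L2Boundary, f ≠ 0 ∧ centeredOp f = (y : ℂ) • f := by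
  induction k generalizing y with
  | zero =>
    rw [nestedRadicals, mem_singleton_iff] at hy
    subst hy
    -- Functions of the first letter satisfy `S = 3`, and `A` kills those whose three values sum to
    -- zero.
    refine ⟨firstLetter ![1, -1, 0], firstLetter_ne_zero (by simp), ?_⟩
    rw [centeredOp_firstLetter, firstLetter_const]
    simp
  | succ k ih =>
    have hy3 : (y : ℂ) ≠ -3 := by
      have := (mem_Ioo_of_mem_nestedRadicals hy).1.ne'
      exact_mod_cast this
    have hy0 : (y : ℂ) ≠ 0 := by
      have : y ≠ 0 := fun h => zero_notMem_nestedRadicals_succ k (h ▸ hy)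
      exact_mod_cast this
    obtain ⟨f, hf, h⟩ := ih (mem_nestedRadicals_succ.1 hy)
    have h' : centeredOp f = ((y : ℂ) ^ 2 - 6) • f := by
      rw [h, quadMap]
      push_cast
      rfl
    refine ⟨_, ?_, renormalization_eigenvector (ι := shiftIso.toLinearMap) (N := centeredOp)
      orbitSum_a_shiftIso (orbitSum_orbitSum s_mul_self) orbitSum_a_orbitSum_s_shiftIso h'⟩
    intro h0
    have hinj := renormalization_injective (ι := shiftIso.toLinearMap) shiftIso.injective
      (orbitSum_orbitSum s_mul_self) hy0 hy3
    exact hf (hinj (h0.trans (map_zero _).symm))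

theorem isClosed_repSpectrum : IsClosed (repSpectrum rep gens) := spectrum.isClosed _

/-- The real points `y` with `1 + y` in the spectrum. -/
theorem setOf_one_add_mem_repSpectrum :
    {y : ℝ | ((1 + y : ℝ) : ℂ) ∈ repSpectrum rep gens} = juliaSet ∪ ⋃ k, nestedRadicals k := by
  have hcast (y : ℝ) : ((1 + y : ℝ) : ℂ) = 1 + (y : ℂ) := by push_cast; rfl
  have hcl : IsClosed {y : ℝ | ((1 + y : ℝ) : ℂ) ∈ repSpectrum rep gens} :=
    isClosed_repSpectrum.preimage (by fun_prop : Continuous fun y : ℝ => ((1 + y : ℝ) : ℂ))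
  refine Subset.antisymm ?_ ?_
  · refine subset_union_of_bounded_invariant (C := ‖heckeOperator rep gens‖ + 1) (fun y hy => ?_) fun y hy => ?_
    · have : Nontrivial L2Boundary :=
        nontrivial_of_ne _ _ (firstLetter_ne_zero (c := fun _ => 1) one_ne_zero)
      have h1 := spectrum.norm_le_norm_of_mem (𝕜 := ℂ) hy
      rw [Complex.norm_real, Real.norm_eq_abs] at h1
      have h2 : |y| ≤ |1 + y| + 1 := by
        have := abs_sub (1 + y) 1
        simpa using this
      linarith
    · rw [mem_ofPred_eq, hcast] at hy
      by_cases h0 : y = 0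
      · exact Or.inl h0
      right
      rw [mem_ofPred_eq, hcast, quadMap]
      -- Renormalization excludes `-3`, but its image `3` is in the shifted spectrum anyway, with
      -- the constants as eigenvectors.
      by_cases h3 : y = -3
      · subst h3
        have := one_add_mem_repSpectrum_of_eigenvector (z := 3)
          (firstLetter_ne_zero (c := fun _ => 1) one_ne_zero) (by
            rw [centeredOp_firstLetter, firstLetter_const]
            norm_num)
        convert this using 2
        norm_num
      · have := sq_sub_six_mem_repSpectrum hy (by exact_mod_cast h0) (by exact_mod_cast h3)
        convert this using 2
        push_cast
        rfl
  · rw [← closure_nestedRadicals]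
    refine hcl.closure_subset_iff.2 (iUnion_subset fun k y hy => ?_)
    obtain ⟨f, hf, h⟩ := exists_eigenvector_of_mem_nestedRadicals hy
    rw [mem_ofPred_eq, hcast]
    exact one_add_mem_repSpectrum_of_eigenvector hf h

/-! ### The closure of the eigenvalues and its Cantor part -/

theorem nestedEigenvalues_eq : nestedEigenvalues = (fun y => 1 + y) '' ⋃ k, nestedRadicals k := by
  ext x
  simp only [nestedEigenvalues, eigenvalueLevel, mem_iUnion, mem_ofPred_eq, mem_image]
  constructor
  · rintro ⟨k, y, hy, rfl⟩
    exact ⟨y, ⟨k, hy⟩, rfl⟩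
  · rintro ⟨y, ⟨k, hy⟩, rfl⟩
    exact ⟨k, y, hy, rfl⟩

theorem countable_nestedEigenvalues : nestedEigenvalues.Countable := by
  rw [nestedEigenvalues_eq]
  refine (countable_iUnion fun k => ?_).image _
  rw [← coe_radicalFinset]
  exact Finset.countable_toSet _

theorem image_one_add_closure (S : Set ℝ) :
    (fun y => 1 + y) '' closure S = closure ((fun y => 1 + y) '' S) :=
  (Homeomorph.addLeft (1 : ℝ)).image_closure S

theorem closure_eigenvalueSet :
    closure eigenvalueSet = (fun y => 1 + y) '' (juliaSet ∪ ⋃ k, nestedRadicals k) := by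
  rw [eigenvalueSet, closure_union, closure_singleton, nestedEigenvalues_eq,
    ← image_one_add_closure, closure_nestedRadicals, union_eq_right, singleton_subset_iff]
  -- The point `4` adds nothing to the closure: `3` is a fixed point of `quadMap`.
  exact ⟨3, Or.inl three_mem_juliaSet, by norm_num⟩

theorem repSpectrum_eq :
    repSpectrum rep gens = (fun x : ℝ => (x : ℂ)) '' closure eigenvalueSet := by
  rw [closure_eigenvalueSet, ← setOf_one_add_mem_repSpectrum]
  ext z
  constructor
  · intro hz
    have hre := (heckeOperator_isSelfAdjoint rep fun _ => inv_mem_gens).mem_spectrum_eq_re hz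
    refine ⟨z.re, ⟨z.re - 1, ?_, by ring⟩, hre.symm⟩
    rw [mem_ofPred_eq, add_sub_cancel, ← hre]
    exact hz
  · rintro ⟨_, ⟨y, hy, rfl⟩, rfl⟩
    exact hy

theorem derivedSet_image_one_add (S : Set ℝ) :
    derivedSet ((fun y => 1 + y) '' S) = (fun y => 1 + y) '' derivedSet S := by
  have key (c : ℝ) (T : Set ℝ) : (fun y => c + y) '' derivedSet T ⊆
      derivedSet ((fun y => c + y) '' T) :=
    (continuous_const_add c).image_derivedSet (add_right_injective c)
  refine Subset.antisymm (fun x hx => ⟨-1 + x, ?_, by ring⟩) (key 1 S)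
  have := key (-1) _ (mem_image_of_mem _ hx)
  rwa [image_image, image_congr (g := id) fun y _ => by simp, image_id] at this

theorem spectrum_structure :
    ∃ K : Set ℝ,
      closure eigenvalueSet = K ∪ nestedEigenvalues ∧
      Disjoint K nestedEigenvalues ∧
      IsCantorSet K ∧
      volume K = 0 ∧
      (∀ x : ℝ, x ∈ K ↔ 2 - x ∈ K) ∧
      nestedEigenvalues.Countable ∧
      (∀ x ∈ nestedEigenvalues, ¬ AccPt x (𝓟 (closure eigenvalueSet))) ∧
      derivedSet nestedEigenvalues = K := by
  have hinj : Function.Injective fun y : ℝ => 1 + y := add_right_injective 1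
  have hcl : closure eigenvalueSet = closure nestedEigenvalues := by
    rw [closure_eigenvalueSet, nestedEigenvalues_eq, ← image_one_add_closure,
      closure_nestedRadicals]
  have hdisj : Disjoint ((fun y => 1 + y) '' juliaSet) nestedEigenvalues := by
    rw [nestedEigenvalues_eq, disjoint_image_iff hinj, disjoint_left]
    intro y hJ hy
    obtain ⟨k, hk⟩ := mem_iUnion.1 hy
    exact notMem_juliaSet_of_mem_nestedRadicals hk hJ
  have hder : derivedSet nestedEigenvalues = (fun y => 1 + y) '' juliaSet := by
    rw [nestedEigenvalues_eq, derivedSet_image_one_add, derivedSet_nestedRadicals]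
  have hsymm : ∀ x ∈ (fun y => 1 + y) '' juliaSet, 2 - x ∈ (fun y => 1 + y) '' juliaSet := by
    rintro _ ⟨y, hy, rfl⟩
    exact ⟨-y, neg_mem_juliaSet hy, by ring⟩
  refine ⟨(fun y => 1 + y) '' juliaSet, ?_, hdisj, ?_, ?_, ?_, countable_nestedEigenvalues, ?_,
    hder⟩
  · rw [closure_eigenvalueSet, image_union, nestedEigenvalues_eq]
  · obtain ⟨e⟩ := nonempty_juliaSet_homeomorph
    exact ⟨((Homeomorph.addLeft (1 : ℝ)).image juliaSet).symm.trans e⟩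
  · rw [image_add_left, measure_preimage_add]
    exact volume_juliaSet
  · exact fun x => ⟨hsymm x, fun h => by simpa using hsymm _ h⟩
  · intro x hx h
    rw [← mem_derivedSet, hcl, derivedSet_closure, hder] at h
    exact disjoint_left.1 hdisj h hx

end FabrykowskiGupta

/-! ### Multiplicities of eigenvalues of a symmetric matrix -/

/-- Eigenvectors of a symmetric matrix for different eigenvalues are orthogonal, so `Ψ w` is
determined by its coordinates along the basis vectors with eigenvalue `μ`. -/
theorem finrank_le_card_eigenvalues_eq {ι W : Type*} [Fintype ι] [DecidableEq ι] [AddCommGroup W]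
    [Module ℝ W] {M : Matrix ι ι ℝ} (hM : M.IsHermitian) {μ : ℝ} {Ψ : W →ₗ[ℝ] ι → ℝ}
    (hinj : Function.Injective Ψ) (hΨ : ∀ w, M.mulVec (Ψ w) = μ • Ψ w) :
    Module.finrank ℝ W ≤ (Finset.univ.filter fun i => hM.eigenvalues i = μ).card := by
  let e (i : ι) : ι → ℝ := hM.eigenvectorBasis i
  have he (i : ι) : M.mulVec (e i) = hM.eigenvalues i • e i := hM.mulVec_eigenvectorBasis i
  have hMt : M.transpose = M := by simpa [Matrix.IsHermitian] using hM
  have hc (w : W) (i : ι) (hi : hM.eigenvalues i ≠ μ) : e i ⬝ᵥ Ψ w = 0 := by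
    have h1 : e i ⬝ᵥ M.mulVec (Ψ w) = M.mulVec (e i) ⬝ᵥ Ψ w := by
      rw [Matrix.dotProduct_mulVec, ← Matrix.mulVec_transpose, hMt]
    rw [hΨ, he, dotProduct_smul, smul_dotProduct, smul_eq_mul, smul_eq_mul] at h1
    exact (mul_eq_zero.1 (by linear_combination -h1 :
      (hM.eigenvalues i - μ) * (e i ⬝ᵥ Ψ w) = 0)).resolve_left (sub_ne_zero.2 hi)
  let C : W →ₗ[ℝ] ({i // hM.eigenvalues i = μ} → ℝ) :=
    { toFun := fun w i => e i.1 ⬝ᵥ Ψ w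
      map_add' := fun v w => funext fun i => by simp [dotProduct_add]
      map_smul' := fun r w => funext fun i => by simp [dotProduct_smul] }
  have hC : Function.Injective C := by
    rw [← LinearMap.ker_eq_bot, LinearMap.ker_eq_bot']
    intro w hw
    have hall (i : ι) : e i ⬝ᵥ Ψ w = 0 := by
      by_cases hi : hM.eigenvalues i = μ
      · exact congrFun hw ⟨i, hi⟩
      · exact hc w i hi
    have hz : (WithLp.toLp 2 (Ψ w) : EuclideanSpace ℝ ι) = 0 := by
      refine hM.eigenvectorBasis.repr.injective ?_
      ext i
      rw [OrthonormalBasis.repr_apply_apply, map_zero]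
      have := hall i
      rw [EuclideanSpace.inner_eq_star_dotProduct, dotProduct_comm]
      simpa using this
    refine hinj ((?_ : Ψ w = 0).trans (map_zero Ψ).symm)
    simpa using hz
  have := LinearMap.finrank_le_finrank_of_injective hC
  rwa [Module.finrank_fintype_fun_eq_card, Fintype.card_subtype] at this

theorem eigenvalueDistribution_singleton {ι : Type*} [Fintype ι] [DecidableEq ι] [Nonempty ι]
    {M : Matrix ι ι ℝ} (hM : M.IsHermitian) (x : ℝ) :
    (eigenvalueDistribution hM : Measure ℝ) {x} = (Fintype.card ι : ENNReal)⁻¹ *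
      ((Finset.univ.filter fun i => hM.eigenvalues i = x).card : ENNReal) := by
  change ((Fintype.card ι : ENNReal)⁻¹ • ∑ i, Measure.dirac (hM.eigenvalues i) : Measure ℝ) {x} = _
  rw [Measure.smul_apply, Measure.finsetSum_apply, smul_eq_mul]
  simp [Set.indicator_apply]

namespace FabrykowskiGupta

open TernaryTree

/-! ### The action on the levels of the tree -/

/-- The action of an automorphism on the words of length `n`. -/
def levelMap {n : ℕ} (g : Aut) (v : List.Vector (Fin 3) n) : List.Vector (Fin 3) n :=
  ⟨g.1 v.1, (Aut.length_map g v.1).trans v.2⟩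

theorem levelMap_mul {n : ℕ} (g h : Aut) (v : List.Vector (Fin 3) n) :
    levelMap (g * h) v = levelMap g (levelMap h v) := rfl

theorem levelMap_one {n : ℕ} (v : List.Vector (Fin 3) n) : levelMap 1 v = v := rfl

/-- The sum `1 + g + g⁻¹` acting on functions on the words of length `n`. -/
def levelSum (n : ℕ) (g : Aut) :
    (List.Vector (Fin 3) n → ℝ) →ₗ[ℝ] List.Vector (Fin 3) n → ℝ :=
  1 + LinearMap.funLeft ℝ ℝ (levelMap g) + LinearMap.funLeft ℝ ℝ (levelMap g⁻¹)

theorem levelSum_apply {n : ℕ} (g : Aut) (f : List.Vector (Fin 3) n → ℝ)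
    (v : List.Vector (Fin 3) n) :
    levelSum n g f v = f v + f (levelMap g v) + f (levelMap g⁻¹ v) := rfl

theorem levelSum_levelSum {n : ℕ} {g : Aut} (hg : g * g = g⁻¹) (f : List.Vector (Fin 3) n → ℝ) :
    levelSum n g (levelSum n g f) = (3 : ℝ) • levelSum n g f := by
  have e : g⁻¹ * g⁻¹ = g := by rw [← mul_inv_rev, hg, inv_inv]
  funext v
  have e1 : levelMap g (levelMap g v) = levelMap g⁻¹ v := by rw [← levelMap_mul, hg]
  have e2 : levelMap g⁻¹ (levelMap g⁻¹ v) = levelMap g v := by rw [← levelMap_mul, e]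
  have e3 : levelMap g (levelMap g⁻¹ v) = v := by
    rw [← levelMap_mul, mul_inv_cancel, levelMap_one]
  have e4 : levelMap g⁻¹ (levelMap g v) = v := by
    rw [← levelMap_mul, inv_mul_cancel, levelMap_one]
  simp only [levelSum_apply, Pi.smul_apply, smul_eq_mul, e1, e2, e3, e4]
  ring

theorem levelMatrix_mulVec {n : ℕ} (g : Gam) (f : List.Vector (Fin 3) n → ℝ)
    (u : List.Vector (Fin 3) n) : (levelMatrix n g).mulVec f u = f (levelMap g.1⁻¹ u) := by
  rw [Matrix.mulVec, dotProduct, Finset.sum_eq_single (levelMap g.1⁻¹ u)]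
  · have : g.1.1 (levelMap g.1⁻¹ u).1 = u.1 := g.1.1.apply_symm_apply u.1
    simp [levelMatrix, this]
  · intro v _ hv
    have : g.1.1 v.1 ≠ u.1 := fun h => hv (Subtype.ext ((Equiv.eq_symm_apply g.1.1).2 h))
    simp [levelMatrix, this]
  · simp

/-- The operator `Δ - 1` on functions on the words of length `n`. -/
def levelCentered (n : ℕ) : (List.Vector (Fin 3) n → ℝ) →ₗ[ℝ] List.Vector (Fin 3) n → ℝ :=
  levelSum n a + levelSum n s - (3 : ℝ) • LinearMap.id

theorem levelCentered_apply {n : ℕ} (f : List.Vector (Fin 3) n → ℝ) :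
    levelCentered n f = levelSum n a f + levelSum n s f - (3 : ℝ) • f := rfl

theorem levelLaplacian_mulVec {n : ℕ} (f : List.Vector (Fin 3) n → ℝ) :
    (levelLaplacian n).mulVec f = levelCentered n f + f := by
  funext u
  have h : (levelLaplacian n).mulVec f u = ∑ g ∈ gens, (levelMatrix n g).mulVec f u := by
    rw [levelLaplacian, Matrix.sum_mulVec, Finset.sum_apply]
  rw [h, sum_gens, levelCentered_apply]
  simp only [levelMatrix_mulVec, Pi.add_apply, Pi.sub_apply, Pi.smul_apply, levelSum_apply,
    smul_eq_mul]
  change f (levelMap a⁻¹ u) + f (levelMap a⁻¹⁻¹ u) + f (levelMap s⁻¹ u) + f (levelMap s⁻¹⁻¹ u) = _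
  rw [inv_inv, inv_inv]
  ring

/-- The restriction of a function on the words of length `n + 1` to those starting with `x`. -/
def letterSection {n : ℕ} (x : Fin 3) :
    (List.Vector (Fin 3) (n + 1) → ℝ) →ₗ[ℝ] List.Vector (Fin 3) n → ℝ :=
  LinearMap.funLeft ℝ ℝ (List.Vector.cons x)

/-- The inflation of a function on the words of length `n` by deletion of the first letter. -/
def inflate {n : ℕ} : (List.Vector (Fin 3) n → ℝ) →ₗ[ℝ] List.Vector (Fin 3) (n + 1) → ℝ :=
  LinearMap.funLeft ℝ ℝ List.Vector.tail

/-- The function on the words of length `n + 1` with given sections. -/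
def glue {n : ℕ} :
    ((List.Vector (Fin 3) n → ℝ) × (List.Vector (Fin 3) n → ℝ) × (List.Vector (Fin 3) n → ℝ)) →ₗ[ℝ]
      List.Vector (Fin 3) (n + 1) → ℝ where
  toFun p v := ![p.1, p.2.1, p.2.2] v.head v.tail
  map_add' p q := by
    funext v
    simp only [Pi.add_apply]
    generalize v.head = x
    fin_cases x <;> rfl
  map_smul' r p := by
    funext v
    simp only [Pi.smul_apply]
    generalize v.head = x
    fin_cases x <;> rfl

variable {n : ℕ}

theorem section_inflate (x : Fin 3) (f : List.Vector (Fin 3) n → ℝ) :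
    letterSection x (inflate f) = f := rfl

theorem inflate_injective : Function.Injective (inflate (n := n)) := fun f g h => by
  rw [← section_inflate 0 f, h, section_inflate]

theorem ext_section {f g : List.Vector (Fin 3) (n + 1) → ℝ} (h0 : letterSection 0 f = letterSection 0 g)
    (h1 : letterSection 1 f = letterSection 1 g) (h2 : letterSection 2 f = letterSection 2 g) : f = g := by
  funext v
  rw [← List.Vector.cons_head_tail v]
  generalize v.head = x
  fin_cases x
  · exact congrFun h0 v.tail
  · exact congrFun h1 v.tail
  · exact congrFun h2 v.tail

theorem section_levelSum_a (x : Fin 3) (f : List.Vector (Fin 3) (n + 1) → ℝ) :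
    letterSection x (levelSum (n + 1) a f) = letterSection 0 f + letterSection 1 f + letterSection 2 f := by
  funext w
  change f (x ::ᵥ w) + f ((x + 1) ::ᵥ w) + f ((x + -1) ::ᵥ w) =
    f (0 ::ᵥ w) + f (1 ::ᵥ w) + f (2 ::ᵥ w)
  fin_cases x
  · rfl
  · change f (1 ::ᵥ w) + f (2 ::ᵥ w) + f (0 ::ᵥ w) = _
    ring
  · change f (2 ::ᵥ w) + f (0 ::ᵥ w) + f (1 ::ᵥ w) = _
    ring

theorem section_levelSum_s_zero (f : List.Vector (Fin 3) (n + 1) → ℝ) :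
    letterSection 0 (levelSum (n + 1) s f) = levelSum n a (letterSection 0 f) := rfl

theorem section_levelSum_s_one (f : List.Vector (Fin 3) (n + 1) → ℝ) :
    letterSection 1 (levelSum (n + 1) s f) = (3 : ℝ) • letterSection 1 f := by
  funext w
  change f (1 ::ᵥ w) + f (1 ::ᵥ w) + f (1 ::ᵥ w) = 3 * f (1 ::ᵥ w)
  ring

theorem section_levelSum_s_two (f : List.Vector (Fin 3) (n + 1) → ℝ) :
    letterSection 2 (levelSum (n + 1) s f) = levelSum n s (letterSection 2 f) := rfl

theorem levelSum_a_inflate (f : List.Vector (Fin 3) n → ℝ) :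
    levelSum (n + 1) a (inflate f) = (3 : ℝ) • inflate f := by
  refine ext_section ?_ ?_ ?_ <;>
  · rw [section_levelSum_a, map_smul]
    simp only [section_inflate]
    module

theorem levelSum_a_levelSum_s_inflate (f : List.Vector (Fin 3) n → ℝ) :
    levelSum (n + 1) a (levelSum (n + 1) s (inflate f)) =
      inflate (levelCentered n f) + (6 : ℝ) • inflate f := by
  refine ext_section ?_ ?_ ?_ <;>
  · rw [section_levelSum_a, section_levelSum_s_zero, section_levelSum_s_one,
      section_levelSum_s_two, map_add, map_smul]
    simp only [section_inflate, levelCentered_apply]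
    module

/-! ### Lower bounds on multiplicities -/

/-- Encodes that the spaces where `A = 3` and where `S = 3` have dimensions adding up to at least `3
^ n`. On level `n + 1` the first contains all inflations, and the second consists of an
`a`-invariant, an arbitrary and an `s`-invariant section. The count therefore triples: one copy from
inflation, one from the section at `1`, one by induction. -/
theorem exists_invariant_pair (n : ℕ) :
    ∃ θ : (List.Vector (Fin 3) n → ℝ) →ₗ[ℝ]
        (List.Vector (Fin 3) n → ℝ) × (List.Vector (Fin 3) n → ℝ),
      Function.Injective θ ∧ (∀ f, levelSum n a (θ f).1 = (3 : ℝ) • (θ f).1) ∧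
        ∀ f, levelSum n s (θ f).2 = (3 : ℝ) • (θ f).2 := by
  induction n with
  | zero =>
    refine ⟨LinearMap.inl ℝ _ _, LinearMap.inl_injective, fun f => ?_, fun f => ?_⟩
    · funext v
      change f v + f (levelMap a v) + f (levelMap a⁻¹ v) = 3 * f v
      rw [Subsingleton.elim (levelMap a v) v, Subsingleton.elim (levelMap a⁻¹ v) v]
      ring
    · simp
  | succ n ih =>
    obtain ⟨θ, hinj, hA, hS⟩ := ih
    refine ⟨(inflate ∘ₗ letterSection 0).prod (glue ∘ₗ ((LinearMap.fst ℝ _ _ ∘ₗ θ ∘ₗ letterSection 2).prod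
      ((letterSection 1).prod (LinearMap.snd ℝ _ _ ∘ₗ θ ∘ₗ letterSection 2)))), ?_, fun f => ?_, fun f => ?_⟩
    · rw [← LinearMap.ker_eq_bot, LinearMap.ker_eq_bot']
      intro f hf
      have h1 : inflate (letterSection 0 f) = 0 := congrArg Prod.fst hf
      have h2 : glue ((θ (letterSection 2 f)).1, letterSection 1 f, (θ (letterSection 2 f)).2) = 0 :=
        congrArg Prod.snd hf
      refine ext_section ?_ ?_ ?_
      · exact (congrArg (letterSection 0) h1).trans (map_zero _)
      · exact (congrArg (letterSection 1) h2).trans (map_zero _)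
      · rw [map_zero]
        refine hinj (Prod.ext ?_ ?_)
        · exact (congrArg (letterSection 0) h2).trans (by simp)
        · exact (congrArg (letterSection 2) h2).trans (by simp)
    · exact levelSum_a_inflate (letterSection 0 f)
    · refine ext_section (hA _) ?_ (hS _)
      rw [section_levelSum_s_one, map_smul]

/-- Sections `p`, `-p - q`, `q` with `p` `a`-invariant and `q` `s`-invariant give a function killed
by `A`, on which `S = 3`. -/
theorem exists_injective_kernel (n : ℕ) :
    ∃ Ψ : (List.Vector (Fin 3) n → ℝ) →ₗ[ℝ] List.Vector (Fin 3) (n + 1) → ℝ,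
      Function.Injective Ψ ∧ ∀ f, levelCentered (n + 1) (Ψ f) = 0 := by
  obtain ⟨θ, hinj, hA, hS⟩ := exists_invariant_pair n
  let p := LinearMap.fst ℝ _ _ ∘ₗ θ
  let q := LinearMap.snd ℝ _ _ ∘ₗ θ
  refine ⟨glue ∘ₗ (p.prod ((-p - q).prod q)), ?_, fun f => ?_⟩
  · intro f g h
    exact hinj (Prod.ext (congrArg (letterSection 0) h) (congrArg (letterSection 2) h))
  · set F := (glue ∘ₗ (p.prod ((-p - q).prod q))) f
    have h0 : letterSection 0 F = (θ f).1 := rfl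
    have h1 : letterSection 1 F = -(θ f).1 - (θ f).2 := rfl
    have h2 : letterSection 2 F = (θ f).2 := rfl
    rw [levelCentered_apply]
    refine ext_section ?_ ?_ ?_
    · rw [map_sub, map_add, section_levelSum_a, section_levelSum_s_zero, map_smul, h0, h1, h2, hA, map_zero]
      module
    · rw [map_sub, map_add, section_levelSum_a, section_levelSum_s_one, map_smul, h0, h1, h2, map_zero]
      module
    · rw [map_sub, map_add, section_levelSum_a, section_levelSum_s_two, map_smul, h0, h1, h2, hS, map_zero]
      module

theorem exists_injective_eigenvectors {k : ℕ} (n : ℕ) {y : ℝ} (hy : y ∈ nestedRadicals k) :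
    ∃ Ψ : (List.Vector (Fin 3) n → ℝ) →ₗ[ℝ] List.Vector (Fin 3) (n + k + 1) → ℝ,
      Function.Injective Ψ ∧ ∀ f, levelCentered (n + k + 1) (Ψ f) = y • Ψ f := by
  induction k generalizing y with
  | zero =>
    rw [nestedRadicals, mem_singleton_iff] at hy
    subst hy
    obtain ⟨Ψ, hinj, h⟩ := exists_injective_kernel n
    exact ⟨Ψ, hinj, fun f => (h f).trans (zero_smul ℝ _).symm⟩
  | succ k ih =>
    have hy0 : y ≠ 0 := fun h => zero_notMem_nestedRadicals_succ k (h ▸ hy)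
    have hy3 : y ≠ -3 := (mem_Ioo_of_mem_nestedRadicals hy).1.ne'
    obtain ⟨Ψ, hinj, h⟩ := ih (mem_nestedRadicals_succ.1 hy)
    refine ⟨(levelSum (n + k + 1 + 1) s ∘ₗ inflate + y • inflate) ∘ₗ Ψ,
      (renormalization_injective inflate_injective (levelSum_levelSum s_mul_self) hy0 hy3).comp
        hinj, fun f => ?_⟩
    change levelCentered (n + k + 1 + 1)
      (levelSum (n + k + 1 + 1) s (inflate (Ψ f)) + y • inflate (Ψ f)) =
        y • (levelSum (n + k + 1 + 1) s (inflate (Ψ f)) + y • inflate (Ψ f))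
    rw [levelCentered_apply]
    exact renormalization_eigenvector (N := levelCentered (n + k + 1)) levelSum_a_inflate
      (levelSum_levelSum s_mul_self) levelSum_a_levelSum_s_inflate (h f)

theorem le_levelSpectralMeasure_singleton {n k : ℕ} (hk : k < n) {y : ℝ}
    (hy : y ∈ nestedRadicals k) :
    (3 : ENNReal)⁻¹ ^ (k + 1) ≤ (levelSpectralMeasure n : Measure ℝ) {1 + y} := by
  obtain ⟨m, rfl⟩ : ∃ m, n = m + k + 1 := ⟨n - k - 1, by omega⟩
  obtain ⟨Ψ, hinj, h⟩ := exists_injective_eigenvectors m hy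
  have hcard := finrank_le_card_eigenvalues_eq (levelLaplacian_isHermitian (m + k + 1))
    (μ := 1 + y) hinj fun f => by
      rw [levelLaplacian_mulVec, h]
      module
  rw [Module.finrank_fintype_fun_eq_card, card_vector, Fintype.card_fin] at hcard
  rw [levelSpectralMeasure, eigenvalueDistribution_singleton, card_vector, Fintype.card_fin]
  calc (3 : ENNReal)⁻¹ ^ (k + 1)
      = ((3 ^ (m + k + 1) : ℕ) : ENNReal)⁻¹ * ((3 ^ m : ℕ) : ENNReal) := by
        push_cast
        rw [add_assoc, ENNReal.inv_pow, pow_add _ m, mul_right_comm, ← mul_pow,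
          ENNReal.inv_mul_cancel (by norm_num) (by norm_num), one_pow, one_mul]
    _ ≤ _ := by gcongr

/-! ### The empiric spectral measure -/

/-- The measure `∑ k, 3⁻⁽ᵏ⁺¹⁾ ∑ x, δ_x`, where `x` ranges over the `k`-th level of eigenvalues. -/
noncomputable def limitMeasure : Measure ℝ :=
  Measure.sum fun k => (3 : ENNReal)⁻¹ ^ (k + 1) • ∑ y ∈ radicalFinset k, Measure.dirac (1 + y)

theorem limitMeasure_apply {T : Set ℝ} (hT : MeasurableSet T) :
    limitMeasure T =
      ∑' k, (3 : ENNReal)⁻¹ ^ (k + 1) * ∑ y ∈ radicalFinset k, T.indicator 1 (1 + y) := by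
  rw [limitMeasure, Measure.sum_apply _ hT]
  simp only [Measure.smul_apply, Measure.finsetSum_apply, smul_eq_mul,
    Measure.dirac_apply' _ hT]

instance : IsProbabilityMeasure limitMeasure := by
  refine ⟨?_⟩
  rw [limitMeasure_apply MeasurableSet.univ]
  -- Depth `k` carries `2 ^ k` atoms of mass `3⁻⁽ᵏ⁺¹⁾`, a geometric series of ratio `2/3`.
  have h3 : (3 : ENNReal)⁻¹ + 2 * 3⁻¹ = 1 := by
    rw [← one_add_mul, show (1 + 2 : ENNReal) = 3 by norm_num]
    exact ENNReal.mul_inv_cancel (by norm_num) (by norm_num)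
  have h2 : (1 : ENNReal) - 2 * 3⁻¹ = 3⁻¹ :=
    ENNReal.sub_eq_of_eq_add (ENNReal.mul_ne_top (by norm_num) (by norm_num)) h3.symm
  have h1 (k : ℕ) : (3 : ENNReal)⁻¹ ^ (k + 1) *
      ∑ y ∈ radicalFinset k, (univ : Set ℝ).indicator 1 (1 + y) = 3⁻¹ * (2 * 3⁻¹) ^ k := by
    simp only [indicator_univ, Pi.one_apply, Finset.sum_const, card_radicalFinset, nsmul_eq_mul,
      mul_one]
    push_cast
    ring
  simp only [h1]
  rw [ENNReal.tsum_mul_left, ENNReal.tsum_geometric, h2, inv_inv]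
  exact ENNReal.inv_mul_cancel (by norm_num) (by norm_num)

theorem limitMeasure_compl : limitMeasure nestedEigenvaluesᶜ = 0 := by
  rw [limitMeasure_apply countable_nestedEigenvalues.measurableSet.compl]
  refine ENNReal.tsum_eq_zero.2 fun k => ?_
  rw [Finset.sum_eq_zero, mul_zero]
  intro y hy
  refine indicator_of_notMem (notMem_compl_iff.2 ?_) _
  rw [nestedEigenvalues_eq]
  exact ⟨y, mem_iUnion.2 ⟨k, mem_radicalFinset.1 hy⟩, rfl⟩

theorem limitMeasure_four : limitMeasure {4} = 0 := by
  refine measure_mono_null (singleton_subset_iff.2 ?_) limitMeasure_compl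
  rw [nestedEigenvalues_eq]
  rintro ⟨y, hy, h⟩
  obtain ⟨k, hk⟩ := mem_iUnion.1 hy
  have h' : 1 + y = 4 := h
  linarith [(mem_Ioo_of_mem_nestedRadicals hk).2]

theorem limitMeasure_singleton {k : ℕ} {x : ℝ} (hx : x ∈ eigenvalueLevel k) :
    limitMeasure {x} = (3 : ENNReal)⁻¹ ^ (k + 1) := by
  obtain ⟨y, hy, rfl⟩ := hx
  rw [limitMeasure_apply (MeasurableSet.singleton _), tsum_eq_single k,
    Finset.sum_eq_single y]
  · simp
  · intro z _ hz
    exact indicator_of_notMem (fun h => hz (add_left_cancel (mem_singleton_iff.1 h))) _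
  · exact fun h => absurd (mem_radicalFinset.2 hy) h
  · intro j hj
    rw [Finset.sum_eq_zero, mul_zero]
    intro z hz
    refine indicator_of_notMem (fun h => hj ?_) _
    obtain rfl : z = y := add_left_cancel (mem_singleton_iff.1 h)
    exact nestedRadicals_disjoint (mem_radicalFinset.1 hz) hy

theorem sum_le_levelSpectralMeasure {m n : ℕ} (hmn : m ≤ n) (G : Set ℝ) :
    ∑ k ∈ Finset.range m, (3 : ENNReal)⁻¹ ^ (k + 1) *
      ∑ y ∈ radicalFinset k, G.indicator 1 (1 + y) ≤ (levelSpectralMeasure n : Measure ℝ) G := by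
  classical
  set I : Finset (Σ _ : ℕ, ℝ) := ((Finset.range m).sigma radicalFinset).filter fun p => 1 + p.2 ∈ G
  have hI {p : Σ _ : ℕ, ℝ} (hp : p ∈ I) :
      p.1 < m ∧ p.2 ∈ nestedRadicals p.1 ∧ 1 + p.2 ∈ G := by
    simpa [I, mem_radicalFinset, and_assoc] using hp
  calc _ = ∑ p ∈ I, (3 : ENNReal)⁻¹ ^ (p.1 + 1) := by
        simp only [I, Finset.sum_filter, Finset.sum_sigma, Finset.mul_sum, indicator_apply,
          Pi.one_apply, mul_ite, mul_one, mul_zero]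
    _ ≤ ∑ p ∈ I, (levelSpectralMeasure n : Measure ℝ) {1 + p.2} :=
        Finset.sum_le_sum fun p hp =>
          le_levelSpectralMeasure_singleton ((hI hp).1.trans_le hmn) (hI hp).2.1
    _ = (levelSpectralMeasure n : Measure ℝ) (⋃ p ∈ I, {1 + p.2}) := by
        refine (measure_biUnion_finset ?_ fun p _ => MeasurableSet.singleton _).symm
        intro p hp q hq hpq
        refine disjoint_singleton.2 fun h => hpq ?_
        obtain ⟨j, y⟩ := p
        obtain ⟨k, z⟩ := q
        obtain rfl : y = z := add_left_cancel h
        obtain rfl : j = k := nestedRadicals_disjoint (hI hp).2.1 (hI hq).2.1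
        rfl
    _ ≤ _ := measure_mono (iUnion₂_subset fun p hp => singleton_subset_iff.2 (hI hp).2.2)

/-- Weak convergence needs only `limitMeasure G ≤ liminf` on open sets `G`, both sides being
probability measures. Each partial sum of `limitMeasure G` is eventually dominated by the level
measures, so no upper bound on multiplicities is required. -/
theorem isEmpiricSpectralMeasure_limitMeasure :
    IsEmpiricSpectralMeasure ⟨limitMeasure, inferInstance⟩ := by
  refine tendsto_of_forall_isOpen_le_liminf_nat' fun G hG => ?_
  change limitMeasure G ≤ _
  rw [limitMeasure_apply hG.measurableSet, ENNReal.tsum_eq_iSup_nat]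
  refine iSup_le fun m => le_liminf_of_le (by isBoundedDefault) ?_
  filter_upwards [eventually_ge_atTop m] with n hn
  exact sum_le_levelSpectralMeasure hn G

end FabrykowskiGupta

theorem mainTheorem7 :
    repSpectrum FabrykowskiGupta.rep FabrykowskiGupta.gens =
        (fun x : ℝ => (x : ℂ)) '' closure FabrykowskiGupta.eigenvalueSet ∧
      (∃ K : Set ℝ,
        closure FabrykowskiGupta.eigenvalueSet = K ∪ FabrykowskiGupta.nestedEigenvalues ∧
        Disjoint K FabrykowskiGupta.nestedEigenvalues ∧
        IsCantorSet K ∧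
        MeasureTheory.volume K = 0 ∧
        (∀ x : ℝ, x ∈ K ↔ 2 - x ∈ K) ∧
        FabrykowskiGupta.nestedEigenvalues.Countable ∧
        (∀ x ∈ FabrykowskiGupta.nestedEigenvalues,
          ¬ AccPt x (Filter.principal (closure FabrykowskiGupta.eigenvalueSet))) ∧
        derivedSet FabrykowskiGupta.nestedEigenvalues = K) ∧
      (∃ τ : MeasureTheory.ProbabilityMeasure ℝ,
        FabrykowskiGupta.IsEmpiricSpectralMeasure τ ∧
        (τ : MeasureTheory.Measure ℝ) FabrykowskiGupta.nestedEigenvaluesᶜ = 0 ∧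
        (τ : MeasureTheory.Measure ℝ) {4} = 0 ∧
        ∀ k : ℕ, ∀ x ∈ FabrykowskiGupta.eigenvalueLevel k,
          (τ : MeasureTheory.Measure ℝ) {x} = (3 : ENNReal)⁻¹ ^ (k + 1)) :=
  ⟨FabrykowskiGupta.repSpectrum_eq, FabrykowskiGupta.spectrum_structure,
    ⟨FabrykowskiGupta.limitMeasure, inferInstance⟩,
    FabrykowskiGupta.isEmpiricSpectralMeasure_limitMeasure, FabrykowskiGupta.limitMeasure_compl,
    FabrykowskiGupta.limitMeasure_four, fun _ _ => FabrykowskiGupta.limitMeasure_singleton⟩
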